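/- Let $a>0$, $1\le r\le n$, and let $f\in C^{2r}(-2a,2a)$ be real valued with $f^{(2r-1)}(0)\ne 0$ and $f^{(2\ell-1)}(0)=0$ for $1\le \ell<r$ (that is, the radial kernel $K(x,y)=f(|x-y|)$ has order of smoothness $r$). Put $f_k=f^{(k)}(0)/k!$. Let $x_1,\dots,x_n\in\mathbb R$ and, for real $\varepsilon$ near $0$, let $$\mathbf K_\varepsilon=\big[f(\varepsilon|x_i-x_j|)\big]_{i,j=1}^n .$$ For $s\ge 1$ let $\mathbf V_{\le s-1}=[x_i^{\,j}]_{1\le i\le n,\,0\le j\le s-1}$ and, for $1\le s\le r$, let $$\mathbf W_{\le s-1}=\Big[\tfrac{1}{i!\,j!}\,\tfrac{\partial^{i+j}K}{\partial x^i\partial y^j}(0,0)\Big]_{i,j=0}^{s-1};$$ let $\mathbf D_{(2r-1)}=\big[|x_i-x_j|^{2r-1}\big]_{i,j=1}^n$. Assume that for some $\varepsilon_0>0$ the matrix $\mathbf K_\varepsilon$ is positive semidefinite for all $\varepsilon\in[0,\varepsilon_0]$, and that $\mathbf K_\varepsilon$ is analytic in $\varepsilon$ at $0$. Then there are functions $\lambda_1,\dots,\lambda_n$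 and pairwise orthogonal rank-one orthogonal projectors $\mathbf P_1,\dots,\mathbf P_n$, all analytic at $0$, such that $\mathbf K_\varepsilon=\sum_{k=1}^n\lambda_k(\varepsilon)\mathbf P_k(\varepsilon)$ for $\varepsilon$ near $0$ and $\lambda_1(\varepsilon)\ge\dots\ge\lambda_n(\varepsilon)$ for small $\varepsilon>0$. For every such decomposition, let $p_1,\dots,p_n$ be the limiting eigenvectors, $\mathbf P_k(0)=p_kp_k^{\mathsf T}$ (each defined up to its sign). There are real numbers (main terms) $\widetilde\lambda_1,\dots,\widetilde\lambda_n$ such that, as $\varepsilon\to0$, $$\lambda_s(\varepsilon)=\varepsilon^{2(s-1)}\big(\widetilde\lambda_s+O(\varepsilon)\big)\ (1\le s\le r),\qquad \lambda_s(\varepsilon)=\varepsilon^{2r-1}\big(\widetilde\lambda_s+O(\varepsilon)\big)\ (r<s\le n),$$ and the following hold. 1. For $1\le s\le r$, $$\widetilde\lambda_1\cdots\widetilde\lambda_s=\det(\mathbf V_{\le s-1}^{\mathsf T}\mathbf V_{\le s-1})\,\det\mathbf W_{\le s-1}.$$ In particular, if $1<s\le r$, $\det\mathbf W_{\le s-2}\neq0$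 and $\det(\mathbf V_{\le s-2}^{\mathsf T}\mathbf V_{\le s-2})\ne0$ (the latter holds if the points are distinct), then $$\widetilde\lambda_s=\frac{\det(\mathbf V_{\le s-1}^{\mathsf T}\mathbf V_{\le s-1})}{\det(\mathbf V_{\le s-2}^{\mathsf T}\mathbf V_{\le s-2})}\cdot\frac{\det\mathbf W_{\le s-1}}{\det\mathbf W_{\le s-2}}.$$ 2. Suppose that the points $x_1,\dots,x_n$ are distinct. If $1\le s\le r$ and $\det\mathbf W_{\le s-1}\ne0$, then, up to signs, $p_1,\dots,p_s$ are the first $s$ columns of $\mathbf Q$ for every full QR factorization $\mathbf V_{\le s-1}=\mathbf Q\mathbf R$ ($\mathbf Q\in\mathbb R^{n\times n}$ orthogonal, $\mathbf R\in\mathbb R^{n\times s}$ upper triangular). If $\det\mathbf W_{\le r-1}\ne0$, then $p_{r+1},\dots,p_n$ span the column space of $\mathbf Q_\perp$, for every $\mathbf Q_\perp\in\mathbb R^{n\times(n-r)}$ with $\mathbf Q_\perp^{\mathsf T}\mathbf Q_\perp=\mathbf I$ and $\mathbf Q_\perp^{\mathsf T}\mathbf V_{\le r-1}=0$. 3. If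 the points are distinct and $\det\mathbf W_{\le r-1}\ne0$, then, for every such $\mathbf Q_\perp$, the numbers $\widetilde\lambda_{r+1},\dots,\widetilde\lambda_n$ are the eigenvalues, counted with multiplicity, of $f_{2r-1}\,\mathbf Q_\perp^{\mathsf T}\mathbf D_{(2r-1)}\mathbf Q_\perp$. -/

import Mathlib

open Filter Topology Asymptotics

namespace FlatLimit

/-- The univariate radial kernel `K(x, y) = f(|x - y|)`. -/
def radialKernel (f : ℝ → ℝ) (x y : ℝ) : ℝ := f |x - y|

/-- The scaled kernel matrix `K_ε = [f(ε |x_i - x_j|)]_{i,j}`, for every real `ε`. -/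
def scaledKernelMatrix {n : ℕ} (f : ℝ → ℝ) (x : Fin n → ℝ) (ε : ℝ) :
    Matrix (Fin n) (Fin n) ℝ :=
  Matrix.of fun i j => f (ε * |x i - x j|)

/-- `f` is of class `C^{2r}` on `(-2a, 2a)` and the radial kernel `f(|x - y|)` has order of
smoothness `r`: the derivative of `f` at `0` of order `2r - 1` is nonzero, and the derivatives of
smaller odd order vanish. -/
structure HasSmoothnessOrder (a : ℝ) (r : ℕ) (f : ℝ → ℝ) : Prop where
  pos : 1 ≤ r
  contDiffOn : ContDiffOn ℝ ((2 * r : ℕ) : WithTop ℕ∞) f (Set.Ioo (-(2 * a)) (2 * a))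
  top_ne_zero : iteratedDeriv (2 * r - 1) f 0 ≠ 0
  lower_eq_zero : ∀ l : ℕ, 1 ≤ l → l < r → iteratedDeriv (2 * l - 1) f 0 = 0

/-- The scaled derivative `f_k = f^{(k)}(0) / k!`. -/
noncomputable def taylorCoeff (f : ℝ → ℝ) (k : ℕ) : ℝ :=
  iteratedDeriv k f 0 / (k.factorial : ℝ)

/-- The mixed partial derivative `∂^{i+j} K / ∂x^i ∂y^j` at `(0, 0)`. -/
noncomputable def mixedDeriv (K : ℝ → ℝ → ℝ) (i j : ℕ) : ℝ :=
  iteratedDeriv i (fun x => iteratedDeriv j (fun y => K x y) 0) 0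

/-- The `s × s` Wronskian matrix `W_{≤ s-1} = [K^{(i,j)}(0,0) / (i! j!)]`, `0 ≤ i, j ≤ s - 1`. -/
noncomputable def wronskian (K : ℝ → ℝ → ℝ) (s : ℕ) : Matrix (Fin s) (Fin s) ℝ :=
  Matrix.of fun i j =>
    mixedDeriv K i j / (((i : ℕ).factorial : ℝ) * ((j : ℕ).factorial : ℝ))

/-- The `n × s` Vandermonde matrix `V_{≤ s-1}`, with columns `1, x, …, x^{s-1}`. -/
def vandermonde {n : ℕ} (x : Fin n → ℝ) (s : ℕ) : Matrix (Fin n) (Fin s) ℝ :=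
  Matrix.of fun i j => x i ^ (j : ℕ)

/-- The Hadamard power `D_{(k)} = [|x_i - x_j|^k]` of the distance matrix. -/
def distPow {n : ℕ} (x : Fin n → ℝ) (k : ℕ) : Matrix (Fin n) (Fin n) ℝ :=
  Matrix.of fun i j => |x i - x j| ^ k

/-- `V = Q R` is a full QR factorization: `Q` is a square orthogonal matrix and `R` is upper
triangular. -/
structure IsFullQR {n m : ℕ} (V : Matrix (Fin n) (Fin m) ℝ) (Q : Matrix (Fin n) (Fin n) ℝ)
    (R : Matrix (Fin n) (Fin m) ℝ) : Prop where
  orthogonal : Q.transpose * Q = 1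
  upper : ∀ (i : Fin n) (j : Fin m), (j : ℕ) < (i : ℕ) → R i j = 0
  eq_mul : V = Q * R

/-- `A(ε) = ∑ λ_k(ε) P_k(ε)` is an eigenvalue decomposition near `ε = 0`, with eigenvalues `λ_k`
and pairwise orthogonal rank-one orthogonal projectors `P_k` all analytic at `0`, the eigenvalues
being numbered in non-increasing order for small `ε > 0`. -/
structure IsAnalyticEVD {n : ℕ} (A : ℝ → Matrix (Fin n) (Fin n) ℝ)
    (lam : Fin n → ℝ → ℝ) (P : Fin n → ℝ → Matrix (Fin n) (Fin n) ℝ) : Prop where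
  analytic_eigenvalue : ∀ k, AnalyticAt ℝ (lam k) 0
  analytic_projector : ∀ k i j, AnalyticAt ℝ (fun ε => P k ε i j) 0
  rank_one : ∀ᶠ ε in 𝓝 (0 : ℝ), ∀ k, ∃ v : Fin n → ℝ,
    v ⬝ᵥ v = 1 ∧ P k ε = Matrix.vecMulVec v v
  orthogonal : ∀ᶠ ε in 𝓝 (0 : ℝ), ∀ j k, j ≠ k → P j ε * P k ε = 0
  decomposition : ∀ᶠ ε in 𝓝 (0 : ℝ), A ε = ∑ k, lam k ε • P k ε
  sorted : ∀ᶠ ε in 𝓝[>] (0 : ℝ), Antitone fun k => lam k ε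

/-- `p_1, …, p_n` are limiting eigenvectors: `P_k(0) = p_k p_kᵀ`. This determines every `p_k` up to
its sign. -/
def IsLimitingEigenvectors {n : ℕ} (P : Fin n → ℝ → Matrix (Fin n) (Fin n) ℝ)
    (p : Fin n → Fin n → ℝ) : Prop :=
  ∀ k, P k 0 = Matrix.vecMulVec (p k) (p k)

/-- `g(ε) = ε^L (c + O(ε))` as `ε → 0`. -/
def HasMainTerm (g : ℝ → ℝ) (L : ℕ) (c : ℝ) : Prop :=
  ∃ h : ℝ → ℝ, h =O[𝓝 0] (fun ε : ℝ => ε) ∧ ∀ᶠ ε in 𝓝 (0 : ℝ), g ε = ε ^ L * (c + h ε)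

/-- The order in `ε` of the eigenvalue with index `k = 0, …, n - 1` (the `(k + 1)`-st one):
`2k` for the first `r` eigenvalues and `2r - 1` for the others. -/
def eigenvalueOrder (r k : ℕ) : ℕ := if k < r then 2 * k else 2 * r - 1

end FlatLimit

/-! Existence is Rellich's theorem. After removal of a scalar function and a power of `ε`, a
symmetric analytic family that is not scalar has a non-scalar value at `0`. It then splits
analytically into two smaller blocks, and induction on the size finishes. Analytic eigenvalues do
not cross on a small interval `(0, δ)`, so one permutation sorts them there.

The rest depends on one cancellation. Below degree `2r - 1` the Taylor coefficients of `K_ε` are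
multiples of `(x_i - x_j)^m`, hence combinations of products `x_i^b x_j^c` with `b + c = m`. If `p`
is orthogonal to the monomials of degree below `i` and `q` to those below `j`, then `pᵀ K_ε q` has
no term of degree below `min (i + j) (2r - 1)`; for `i + j ≤ 2r - 2`, its coefficient of degree `i +
j` is a Wronskian entry times the two leading moments.

Orders: the first `k + 1` eigenvectors span a vector orthogonal to `min k r` monomials. Its Rayleigh
quotient bounds `λ_k` from above, positivity bounds it from below, and analyticity turns the bound
into a main term.

Main terms: in an orthonormal basis adapted to the monomials, the rows and columns of `z ε^(2s-1) -
K_ε` are divided by suitable powers of `ε`. The determinant converges to that of a block triangular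
matrix, and the product over eigenvalues converges too. Comparing these polynomials in `z` gives the
product formula (`det_mul_det_eq_of_graded`, `det_eq_prod_of_forall_det_mul_det_eq`) and, for `s =
r`, the characteristic polynomial of the projected distance matrix.

Eigenvectors: `λ_k P_k ≤ K_ε` as quadratic forms. If `q` is orthogonal to the monomials of degree at
most `k < r`, then `qᵀ K_ε q = o(ε^(2k))`, so a nonzero main term forces `q ⟂ p_k`. -/

namespace FlatLimit

/-! ### Analytic block diagonalization by the inverse function theorem -/

section
attribute [local instance] Matrix.linftyOpNormedRing Matrix.linftyOpNormedAlgebra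

variable {ι : Type*} [Fintype ι]

/-- The part of a matrix that is supported on the pairs `(i, j)` with `p i ↔ p j` false. -/
noncomputable def offPart (p : ι → Prop) [DecidablePred p] : Matrix ι ι ℝ →L[ℝ] Matrix ι ι ℝ :=
  LinearMap.toContinuousLinearMap
    { toFun := fun M => Matrix.of fun i j => if (p i ↔ p j) then 0 else M i j
      map_add' := fun M N => by ext i j; by_cases h : (p i ↔ p j) <;> simp [h]
      map_smul' := fun a M => by ext i j; by_cases h : (p i ↔ p j) <;> simp [h] }

theorem offPart_apply (p : ι → Prop) [DecidablePred p] (M : Matrix ι ι ℝ) (i j : ι) :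
    offPart p M i j = if (p i ↔ p j) then 0 else M i j := rfl

variable [DecidableEq ι]

theorem analyticAt_matrix_iff {A : ℝ → Matrix ι ι ℝ} {t : ℝ} :
    AnalyticAt ℝ A t ↔ ∀ i j, AnalyticAt ℝ (fun ε => A ε i j) t := by
  constructor
  · intro h i j
    exact (LinearMap.toContinuousLinearMap (Matrix.entryLinearMap ℝ ℝ i j)).analyticAt _ |>.comp h
  · intro h
    have : A = fun ε => ∑ i, ∑ j, A ε i j • Matrix.single i j (1 : ℝ) := by
      funext ε
      conv_lhs => rw [Matrix.matrix_eq_sum_single (A ε)]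
      simp
    rw [this]
    refine Finset.analyticAt_fun_sum _ fun i _ => Finset.analyticAt_fun_sum _ fun j _ => ?_
    exact (h i j).smul analyticAt_const

/-- Conjugation of `C + (block part of M)` by the exponential of the off-diagonal part of `M`. -/
noncomputable def expConj (p : ι → Prop) [DecidablePred p] (C M : Matrix ι ι ℝ) : Matrix ι ι ℝ :=
  NormedSpace.exp (offPart p M) * (C + (M - offPart p M)) * NormedSpace.exp (-offPart p M)

theorem analyticAt_expConj (p : ι → Prop) [DecidablePred p] (C M : Matrix ι ι ℝ) :
    AnalyticAt ℝ (expConj p C) M := by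
  have ho : AnalyticAt ℝ (fun M => offPart p M) M := (offPart p).analyticAt M
  have hexp : ∀ N : Matrix ι ι ℝ, AnalyticAt ℝ NormedSpace.exp N :=
    fun N => NormedSpace.exp_analytic (𝕂 := ℝ) N
  have h1 : AnalyticAt ℝ (fun M => NormedSpace.exp (offPart p M)) M := (hexp _).comp ho
  have h2 : AnalyticAt ℝ (fun M => NormedSpace.exp (-offPart p M)) M := (hexp _).comp ho.neg
  exact (h1.mul (analyticAt_const.add (analyticAt_id.sub ho))).mul h2

/-- To first order, conjugation by the exponential of `X` adds the commutator `X C - C X`, and the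
block part of `M` enters linearly. -/
theorem hasFDerivAt_expConj (p : ι → Prop) [DecidablePred p] (C : Matrix ι ι ℝ) :
    ∃ D : Matrix ι ι ℝ →L[ℝ] Matrix ι ι ℝ, HasFDerivAt (expConj p C) D 0 ∧
      ∀ M, D M = offPart p M * C + (M - offPart p M) - C * offPart p M := by
  have ho : HasFDerivAt (fun M => offPart p M) (offPart p) 0 := (offPart p).hasFDerivAt
  have hexp : HasFDerivAt (NormedSpace.exp : Matrix ι ι ℝ → _)
      (1 : Matrix ι ι ℝ →L[ℝ] Matrix ι ι ℝ) (offPart p 0) := by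
    rw [map_zero]; exact (hasStrictFDerivAt_exp_zero (𝕂 := ℝ)).hasFDerivAt
  have hexp' : HasFDerivAt (NormedSpace.exp : Matrix ι ι ℝ → _)
      (1 : Matrix ι ι ℝ →L[ℝ] Matrix ι ι ℝ) (-offPart p 0) := by
    rw [map_zero, neg_zero]; exact (hasStrictFDerivAt_exp_zero (𝕂 := ℝ)).hasFDerivAt
  have h1 := hexp.comp (0 : Matrix ι ι ℝ) ho
  have h2 := hexp'.comp (0 : Matrix ι ι ℝ) ho.neg
  have h3 := ((hasFDerivAt_const C (0 : Matrix ι ι ℝ)).add ((hasFDerivAt_id 0).sub ho))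
  refine ⟨_, (h1.mul' h3).mul' h2, fun M => ?_⟩
  have e0 : NormedSpace.exp (0 : Matrix ι ι ℝ) = 1 := NormedSpace.exp_zero
  change NormedSpace.exp (offPart p 0) * (C + (0 - offPart p 0)) * -(offPart p M) +
    (NormedSpace.exp (offPart p 0) * (0 + (M - offPart p M)) +
      offPart p M * (C + (0 - offPart p 0))) * NormedSpace.exp (-offPart p 0) = _
  simp only [map_zero, neg_zero, e0, sub_zero, add_zero, zero_add, mul_one, one_mul, mul_neg]
  abel

/-- The argument on the right transposes the block part of `M` and replaces the off-diagonal part by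
minus its transpose. Its fixed points therefore have a skew off-diagonal part, whose exponential is
orthogonal. -/
theorem expConj_transpose (p : ι → Prop) [DecidablePred p] (c : ι → ℝ) (M : Matrix ι ι ℝ) :
    (expConj p (Matrix.diagonal c) M).transpose =
      expConj p (Matrix.diagonal c)
        (M.transpose - offPart p M.transpose - offPart p M.transpose) := by
  have h1 : offPart p (M.transpose - offPart p M.transpose - offPart p M.transpose) =
      -(offPart p M).transpose := by
    ext i j
    by_cases h : (p i ↔ p j)
    · simp [offPart_apply, h]
    · have h' : ¬(p j ↔ p i) := fun e => h e.symm
      simp [offPart_apply, h, h']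
  have h2 : (offPart p M).transpose = offPart p M.transpose := by
    ext i j
    simp [offPart_apply, iff_comm]
  unfold expConj
  rw [h1, Matrix.transpose_mul, Matrix.transpose_mul, ← Matrix.exp_transpose,
    ← Matrix.exp_transpose, ← mul_assoc, h2]
  simp [h2]


/-- The derivative of `expConj` at `0` is the identity on the block part and multiplies each
off-diagonal entry by `c j - c i ≠ 0`, so `expConj` has an analytic local inverse. Skewness follows
from the uniqueness of the local preimage of a symmetric matrix. -/
theorem eventually_expConj_eq (p : ι → Prop) [DecidablePred p] (c : ι → ℝ)
    (hc : ∀ i j, ¬(p i ↔ p j) → c i ≠ c j) {C : ℝ → Matrix ι ι ℝ} (hC : AnalyticAt ℝ C 0)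
    (hC0 : C 0 = Matrix.diagonal c) (hsymm : ∀ᶠ ε in 𝓝 (0 : ℝ), (C ε).transpose = C ε) :
    ∃ M : ℝ → Matrix ι ι ℝ, AnalyticAt ℝ M 0 ∧
      (∀ᶠ ε in 𝓝 (0 : ℝ), expConj p (Matrix.diagonal c) (M ε) = C ε) ∧
      ∀ᶠ ε in 𝓝 (0 : ℝ), (offPart p (M ε)).transpose = -offPart p (M ε) := by
  obtain ⟨D, hD, hDM⟩ := hasFDerivAt_expConj p (Matrix.diagonal c)
  have hinj : Function.Injective D := by
    rw [injective_iff_map_eq_zero]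
    intro M hM
    rw [hDM] at hM
    ext i j
    have h := congrFun (congrFun hM i) j
    simp only [Matrix.sub_apply, Matrix.add_apply, Matrix.mul_diagonal, Matrix.diagonal_mul,
      offPart_apply, Matrix.zero_apply] at h
    by_cases hp : (p i ↔ p j)
    · simpa [hp] using h
    · simp only [if_neg hp, sub_self, add_zero] at h
      have h' : (c j - c i) * M i j = 0 := by linarith
      exact (mul_eq_zero.1 h').resolve_left (sub_ne_zero.2 (hc i j hp).symm)
  let e : Matrix ι ι ℝ ≃L[ℝ] Matrix ι ι ℝ :=
    (LinearEquiv.ofInjectiveEndo (D : Matrix ι ι ℝ →ₗ[ℝ] Matrix ι ι ℝ) hinj).toContinuousLinearEquiv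
  have he : HasFDerivAt (expConj p (Matrix.diagonal c)) (e : Matrix ι ι ℝ →L[ℝ] Matrix ι ι ℝ) 0 := by
    convert hD using 1
    ext1 M
    rfl
  have hsm : ContDiffAt ℝ (⊤ : WithTop ℕ∞) (expConj p (Matrix.diagonal c)) 0 :=
    (analyticAt_expConj p _ 0).contDiffAt
  have h0 : expConj p (Matrix.diagonal c) 0 = C 0 := by
    simp [expConj, hC0, NormedSpace.exp_zero]
  let R := hsm.toOpenPartialHomeomorph _ he (by simp)
  have hR : ∀ M, R M = expConj p (Matrix.diagonal c) M := fun _ => rfl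
  have h0s : (0 : Matrix ι ι ℝ) ∈ R.source := hsm.mem_toOpenPartialHomeomorph_source he (by simp)
  have h0t : C 0 ∈ R.target := by rw [← h0, ← hR]; exact R.map_source h0s
  have hsymm0 : R.symm (C 0) = 0 := by rw [← h0, ← hR, R.left_inv h0s]
  have han : AnalyticAt ℝ R.symm (C 0) := by
    refine R.analyticAt_symm (i := e) h0t ?_ ?_
    · rw [hsymm0]; exact analyticAt_expConj p _ 0
    · rw [hsymm0]; exact he.fderiv
  have hCt : ∀ᶠ ε in 𝓝 (0 : ℝ), C ε ∈ R.target :=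
    hC.continuousAt.eventually (R.open_target.mem_nhds h0t)
  have hM : AnalyticAt ℝ (fun ε => R.symm (C ε)) 0 := han.comp hC
  have hM0 : Tendsto (fun ε => R.symm (C ε)) (𝓝 0) (𝓝 0) := by
    have := hM.continuousAt.tendsto
    rwa [hsymm0] at this
  let τ : Matrix ι ι ℝ → Matrix ι ι ℝ := fun M =>
    M.transpose - offPart p M.transpose - offPart p M.transpose
  have hτ : Tendsto (fun ε => τ (R.symm (C ε))) (𝓝 0) (𝓝 0) := by
    have hc : Continuous τ := by
      have h1 : Continuous fun M : Matrix ι ι ℝ => M.transpose := continuous_id.matrix_transpose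
      have h2 : Continuous fun M : Matrix ι ι ℝ => offPart p M.transpose :=
        (offPart p).continuous.comp h1
      exact (h1.sub h2).sub h2
    have h0 : τ 0 = 0 := by simp [τ]
    have := (hc.tendsto 0).comp hM0
    rwa [h0] at this
  refine ⟨fun ε => R.symm (C ε), hM, ?_, ?_⟩
  · filter_upwards [hCt] with ε h
    rw [← hR, R.right_inv h]
  · filter_upwards [hCt, hsymm, hτ.eventually (R.open_source.mem_nhds h0s)] with ε h hs hτs
    -- Both `M` and `τ M` lie in the domain of injectivity and map to the symmetric matrix `C ε`, so
    -- they coincide.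
    have h1 : R (τ (R.symm (C ε))) = R (R.symm (C ε)) := by
      rw [hR, ← expConj_transpose, ← hR, R.right_inv h, hs]
    have h2 : τ (R.symm (C ε)) = R.symm (C ε) := R.injOn hτs (R.map_target h) h1
    ext i j
    have h3 := congrFun (congrFun h2 i) j
    have h4 := congrFun (congrFun h2 j) i
    by_cases hp : (p i ↔ p j)
    · have hp' : (p j ↔ p i) := hp.symm
      simp only [Matrix.transpose_apply, Matrix.neg_apply, offPart_apply, if_pos hp, if_pos hp',
        neg_zero]
    · have hp' : ¬(p j ↔ p i) := fun e => hp e.symm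
      simp only [τ, Matrix.sub_apply, Matrix.transpose_apply, offPart_apply, if_neg hp,
        if_neg hp'] at h3 h4
      simp only [Matrix.transpose_apply, Matrix.neg_apply, offPart_apply, if_neg hp, if_neg hp']
      linarith

/-- Analytic block diagonalization of a symmetric matrix whose value at `0` is diagonal, with
distinct eigenvalues on the two blocks. -/
theorem exists_analytic_blockDiag (p : ι → Prop) (c : ι → ℝ)
    (hc : ∀ i j, ¬(p i ↔ p j) → c i ≠ c j) {C : ℝ → Matrix ι ι ℝ}
    (hC : ∀ i j, AnalyticAt ℝ (fun ε => C ε i j) 0)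
    (hC0 : C 0 = Matrix.diagonal c) (hsymm : ∀ᶠ ε in 𝓝 (0 : ℝ), (C ε).transpose = C ε) :
    ∃ U : ℝ → Matrix ι ι ℝ, (∀ i j, AnalyticAt ℝ (fun ε => U ε i j) 0) ∧
      (∀ᶠ ε in 𝓝 (0 : ℝ), (U ε).transpose * U ε = 1) ∧
      ∀ᶠ ε in 𝓝 (0 : ℝ), ∀ i j, ¬(p i ↔ p j) → ((U ε).transpose * C ε * U ε) i j = 0 := by
  classical
  obtain ⟨M, hM, hMC, hMs⟩ := eventually_expConj_eq p c hc (analyticAt_matrix_iff.2 hC) hC0 hsymm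
  have hinv : ∀ N : Matrix ι ι ℝ, NormedSpace.exp (-N) * NormedSpace.exp N = 1 := by
    intro N
    have := (Matrix.exp_add_of_commute (-N) N (Commute.neg_left (Commute.refl N))).symm
    simpa using this
  refine ⟨fun ε => NormedSpace.exp (offPart p (M ε)), ?_, ?_, ?_⟩
  · refine analyticAt_matrix_iff.1 ?_
    exact (NormedSpace.exp_analytic (𝕂 := ℝ) _).comp (((offPart p).analyticAt _).comp hM)
  · filter_upwards [hMs] with ε h
    rw [← Matrix.exp_transpose, h, hinv]
  · filter_upwards [hMs, hMC] with ε h h' i j hij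
    rw [← Matrix.exp_transpose, h, ← h']
    have : NormedSpace.exp (-offPart p (M ε)) * expConj p (Matrix.diagonal c) (M ε) *
        NormedSpace.exp (offPart p (M ε)) = Matrix.diagonal c + (M ε - offPart p (M ε)) := by
      unfold expConj
      rw [← mul_assoc, ← mul_assoc, hinv, one_mul, mul_assoc, hinv, mul_one]
    rw [this]
    have hne : i ≠ j := by rintro rfl; exact hij Iff.rfl
    simp [offPart_apply, hij, hne]

end

/-! ### Rellich's theorem -/

theorem eventuallyEq_of_pow_mul {f g : ℝ → ℝ} (hf : AnalyticAt ℝ f 0) (hg : AnalyticAt ℝ g 0)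
    (m : ℕ) (h : ∀ᶠ ε in 𝓝 (0 : ℝ), ε ^ m * f ε = ε ^ m * g ε) : f =ᶠ[𝓝 0] g := by
  refine (hf.frequently_eq_iff_eventually_eq hg).1 (Eventually.frequently ?_)
  filter_upwards [h.filter_mono nhdsWithin_le_nhds, self_mem_nhdsWithin] with ε h1 h2
  exact mul_left_cancel₀ (pow_ne_zero _ h2) h1

section
variable {ι : Type*} [Fintype ι]

theorem analyticAt_mul_apply {A B : ℝ → Matrix ι ι ℝ}
    (hA : ∀ i j, AnalyticAt ℝ (fun ε => A ε i j) 0)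
    (hB : ∀ i j, AnalyticAt ℝ (fun ε => B ε i j) 0) (i j : ι) :
    AnalyticAt ℝ (fun ε => (A ε * B ε) i j) 0 := by
  simp only [Matrix.mul_apply]
  exact Finset.analyticAt_fun_sum _ fun k _ => (hA i k).mul (hB k j)

variable [DecidableEq ι]

/-- A family of symmetric matrices that is not scalar near `0` is, up to a scalar function,
a power of the parameter times a family whose value at `0` is not scalar. -/
theorem exists_eq_scalar_add_pow_smul [Nonempty ι] {A : ℝ → Matrix ι ι ℝ}
    (hA : ∀ i j, AnalyticAt ℝ (fun ε => A ε i j) 0)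
    (hsymm : ∀ᶠ ε in 𝓝 (0 : ℝ), (A ε).transpose = A ε) :
    ∃ a : ℝ → ℝ, AnalyticAt ℝ a 0 ∧ ((∀ᶠ ε in 𝓝 (0 : ℝ), A ε = a ε • (1 : Matrix ι ι ℝ)) ∨
      ∃ (m : ℕ) (C : ℝ → Matrix ι ι ℝ), (∀ i j, AnalyticAt ℝ (fun ε => C ε i j) 0) ∧
        (∀ᶠ ε in 𝓝 (0 : ℝ), (C ε).transpose = C ε) ∧ (∀ c : ℝ, C 0 ≠ c • (1 : Matrix ι ι ℝ)) ∧
        ∀ᶠ ε in 𝓝 (0 : ℝ), A ε = a ε • (1 : Matrix ι ι ℝ) + ε ^ m • C ε) := by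
  obtain ⟨i₀⟩ := ‹Nonempty ι›
  -- Subtracting this diagonal entry makes the `(i₀, i₀)` entry of `C` vanish, so a scalar `C 0`
  -- would be zero. With `m` the least order among the entries, some entry of `C 0` is nonzero.
  refine ⟨fun ε => A ε i₀ i₀, hA i₀ i₀, ?_⟩
  set B : ℝ → Matrix ι ι ℝ := fun ε => A ε - A ε i₀ i₀ • (1 : Matrix ι ι ℝ) with hBdef
  have hB : ∀ i j, AnalyticAt ℝ (fun ε => B ε i j) 0 := fun i j => by
    simp only [hBdef, Matrix.sub_apply, Matrix.smul_apply, smul_eq_mul]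
    exact (hA i j).sub ((hA i₀ i₀).mul analyticAt_const)
  have hAB : ∀ ε, A ε = A ε i₀ i₀ • (1 : Matrix ι ι ℝ) + B ε := fun ε => by simp [hBdef]
  obtain ⟨q, -, hq⟩ := Finset.exists_min_image (Finset.univ : Finset (ι × ι))
    (fun q => analyticOrderAt (fun ε => B ε q.1 q.2) 0) ⟨(i₀, i₀), Finset.mem_univ _⟩
  by_cases htop : analyticOrderAt (fun ε => B ε q.1 q.2) 0 = ⊤
  · left
    have hz : ∀ i j, ∀ᶠ ε in 𝓝 (0 : ℝ), B ε i j = 0 := fun i j => by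
      have := hq (i, j) (Finset.mem_univ _)
      rw [htop, top_le_iff, analyticOrderAt_eq_top] at this
      exact this
    filter_upwards [eventually_all.2 fun i => eventually_all.2 (hz i)] with ε h
    rw [hAB ε]
    have : B ε = 0 := by ext i j; exact h i j
    simp [this]
  · right
    obtain ⟨m, hm⟩ := ENat.ne_top_iff_exists.1 htop
    have hex : ∀ i j, ∃ g : ℝ → ℝ, AnalyticAt ℝ g 0 ∧ ∀ᶠ ε in 𝓝 (0 : ℝ), B ε i j = ε ^ m * g ε := by
      intro i j
      have h := hq (i, j) (Finset.mem_univ _)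
      rw [← hm, natCast_le_analyticOrderAt (hB i j)] at h
      simpa using h
    choose C hCan hC using hex
    have hCe : ∀ᶠ ε in 𝓝 (0 : ℝ), ∀ i j, B ε i j = ε ^ m * C i j ε :=
      eventually_all.2 fun i => eventually_all.2 (hC i)
    refine ⟨m, fun ε => Matrix.of fun i j => C i j ε, hCan, ?_, ?_, ?_⟩
    · have : ∀ i j, C i j =ᶠ[𝓝 0] C j i := fun i j => by
        refine eventuallyEq_of_pow_mul (hCan i j) (hCan j i) m ?_
        filter_upwards [hCe, hsymm] with ε h hs
        rw [← h, ← h]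
        have hs' : A ε i j = A ε j i := by conv_lhs => rw [← hs, Matrix.transpose_apply]
        have h1 : (1 : Matrix ι ι ℝ) i j = (1 : Matrix ι ι ℝ) j i := by
          simp [Matrix.one_apply, eq_comm]
        simp [hBdef, hs', h1]
      filter_upwards [eventually_all.2 fun i => eventually_all.2 (this i)] with ε h
      ext i j
      exact h j i
    · intro c hc
      have h0 : C i₀ i₀ =ᶠ[𝓝 0] 0 := by
        refine eventuallyEq_of_pow_mul (hCan i₀ i₀) analyticAt_const m ?_
        filter_upwards [hCe] with ε h
        rw [← h]
        simp [hBdef]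
      have hc0 : c = 0 := by
        have h1 := congrFun (congrFun hc i₀) i₀
        have h2 : C i₀ i₀ 0 = 0 := h0.self_of_nhds
        simpa [h2] using h1.symm
      have h1 : C q.1 q.2 0 = 0 := by
        have := congrFun (congrFun hc q.1) q.2
        simpa [hc0] using this
      obtain ⟨g, hg, hg0, hgB⟩ := ((hB q.1 q.2).analyticOrderAt_eq_natCast (n := m)).1 hm.symm
      have h2 : C q.1 q.2 =ᶠ[𝓝 0] g := by
        refine eventuallyEq_of_pow_mul (hCan _ _) hg m ?_
        filter_upwards [hCe, hgB] with ε h h'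
        rw [← h, h']
        simp
      exact hg0 (h2.self_of_nhds ▸ h1)
    · filter_upwards [hCe] with ε h
      rw [hAB ε]
      congr 1
      · simp [hBdef]
      · ext i j
        simpa using h i j
end

/-- **Rellich's theorem**: a symmetric matrix depending analytically on a real parameter can be
diagonalized by an orthogonal matrix depending analytically on the parameter. -/
theorem exists_analytic_diagonalization {ι : Type*} [Fintype ι] [DecidableEq ι]
    {A : ℝ → Matrix ι ι ℝ} (hA : ∀ i j, AnalyticAt ℝ (fun ε => A ε i j) 0)
    (hsymm : ∀ᶠ ε in 𝓝 (0 : ℝ), (A ε).transpose = A ε) :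
    ∃ (U : ℝ → Matrix ι ι ℝ) (d : ι → ℝ → ℝ), (∀ i j, AnalyticAt ℝ (fun ε => U ε i j) 0) ∧
      (∀ i, AnalyticAt ℝ (d i) 0) ∧ (∀ᶠ ε in 𝓝 (0 : ℝ), (U ε).transpose * U ε = 1) ∧
      ∀ᶠ ε in 𝓝 (0 : ℝ), (U ε).transpose * A ε * U ε = Matrix.diagonal fun i => d i ε := by
  induction hN : Fintype.card ι using Nat.strong_induction_on generalizing ι with
  | _ N ih =>
  cases isEmpty_or_nonempty ι with
  | inl h =>
    exact ⟨fun _ => 1, fun _ _ => 0, fun i => isEmptyElim i, fun i => isEmptyElim i,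
      Eventually.of_forall fun _ => Subsingleton.elim _ _,
      Eventually.of_forall fun _ => Subsingleton.elim _ _⟩
  | inr hne =>
  obtain ⟨a, ha, h | ⟨m, C, hC, hCs, hC0, hAC⟩⟩ := exists_eq_scalar_add_pow_smul hA hsymm
  · refine ⟨fun _ => 1, fun _ => a, fun _ _ => analyticAt_const, fun _ => ha, by simp, ?_⟩
    filter_upwards [h] with ε h
    rw [h]
    simp [Matrix.smul_one_eq_diagonal]
  have hherm : (C 0).IsHermitian := by
    rw [Matrix.IsHermitian, Matrix.conjTranspose_eq_transpose_of_trivial]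
    exact hCs.self_of_nhds
  obtain ⟨Q, c, hQ, hQC⟩ : ∃ (Q : Matrix ι ι ℝ) (c : ι → ℝ), Q.transpose * Q = 1 ∧
      Q.transpose * C 0 * Q = Matrix.diagonal c := by
    have h1 : ∀ M : Matrix ι ι ℝ, star M = M.transpose := fun M => by
      rw [Matrix.star_eq_conjTranspose, Matrix.conjTranspose_eq_transpose_of_trivial]
    refine ⟨hherm.eigenvectorUnitary, hherm.eigenvalues, ?_, ?_⟩
    · rw [← h1]
      exact Unitary.coe_star_mul_self _
    · rw [← h1]
      have := hherm.conjStarAlgAut_star_eigenvectorUnitary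
      rwa [Unitary.conjStarAlgAut_star_apply] at this
  have hQ' : Q * Q.transpose = 1 := mul_eq_one_comm.1 hQ
  obtain ⟨i₁, i₂, hi⟩ : ∃ i₁ i₂, c i₁ ≠ c i₂ := by
    by_contra! hcon
    refine hC0 (c (Classical.arbitrary ι)) ?_
    have h1 : Matrix.diagonal c = c (Classical.arbitrary ι) • (1 : Matrix ι ι ℝ) := by
      rw [Matrix.smul_one_eq_diagonal]
      congr 1
      funext i
      exact hcon _ _
    calc C 0 = Q * (Q.transpose * C 0 * Q) * Q.transpose := by
          simp only [mul_assoc, hQ', mul_one]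
          simp only [← mul_assoc, hQ', one_mul]
      _ = _ := by
          rw [hQC, h1]
          simp [hQ']
  -- The index `i₁` is in one block and `i₂` in the other, so both blocks are strictly smaller than
  -- `ι`.
  let p : ι → Prop := fun i => c i = c i₁
  classical
  have hconst : ∀ i j, AnalyticAt ℝ (fun _ : ℝ => Q i j) 0 := fun _ _ => analyticAt_const
  obtain ⟨U, hU, hUo, hUb⟩ := exists_analytic_blockDiag (C := fun ε => Q.transpose * C ε * Q) p c
    (fun i j hij e => hij (by simp [p, e]))
    (analyticAt_mul_apply (analyticAt_mul_apply (fun i j => hconst j i) hC) hconst) hQC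
    (by filter_upwards [hCs] with ε h
        simp [Matrix.transpose_mul, h, mul_assoc])
  set T : ℝ → Matrix ι ι ℝ := fun ε => Q * U ε with hTdef
  have hT : ∀ i j, AnalyticAt ℝ (fun ε => T ε i j) 0 := analyticAt_mul_apply hconst hU
  have hTo : ∀ᶠ ε in 𝓝 (0 : ℝ), (T ε).transpose * T ε = 1 := by
    filter_upwards [hUo] with ε h
    simp only [hTdef, Matrix.transpose_mul]
    rw [mul_assoc, ← mul_assoc Q.transpose, hQ, one_mul, h]
  set S : ℝ → Matrix ι ι ℝ := fun ε => (T ε).transpose * C ε * T ε with hSdef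
  have hS : ∀ i j, AnalyticAt ℝ (fun ε => S ε i j) 0 :=
    analyticAt_mul_apply (analyticAt_mul_apply (fun i j => hT j i) hC) hT
  have hSs : ∀ᶠ ε in 𝓝 (0 : ℝ), (S ε).transpose = S ε := by
    filter_upwards [hCs] with ε h
    simp [hSdef, Matrix.transpose_mul, h, mul_assoc]
  have hSb : ∀ᶠ ε in 𝓝 (0 : ℝ), ∀ i j, ¬(p i ↔ p j) → S ε i j = 0 := by
    filter_upwards [hUb] with ε h i j hij
    rw [← h i j hij]
    simp [hSdef, hTdef, Matrix.transpose_mul, mul_assoc]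
  have hSsub : ∀ q : ι → Prop, ∀ᶠ ε in 𝓝 (0 : ℝ),
      ((S ε).submatrix (Subtype.val : {i // q i} → ι) Subtype.val).transpose =
        (S ε).submatrix (Subtype.val : {i // q i} → ι) Subtype.val := fun q => by
    filter_upwards [hSs] with ε h
    rw [Matrix.transpose_submatrix, h]
  obtain ⟨U₁, d₁, hU₁, hd₁, hU₁o, hU₁d⟩ := ih (Fintype.card {i // p i})
    (hN ▸ Fintype.card_subtype_lt (x := i₂) (fun h => hi h.symm))
    (ι := {i // p i})
    (A := fun ε => (S ε).submatrix (Subtype.val : {i // p i} → ι) Subtype.val)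
    (fun i j => hS i.1 j.1) (hSsub p) rfl
  obtain ⟨U₂, d₂, hU₂, hd₂, hU₂o, hU₂d⟩ := ih (Fintype.card {i // ¬p i})
    (hN ▸ Fintype.card_subtype_lt (x := i₁) (fun h => h rfl))
    (ι := {i // ¬p i})
    (A := fun ε => (S ε).submatrix (Subtype.val : {i // ¬p i} → ι) Subtype.val)
    (fun i j => hS i.1 j.1) (hSsub fun i => ¬p i) rfl
  let e := Equiv.sumCompl p
  have hSe : ∀ᶠ ε in 𝓝 (0 : ℝ), S ε = (Matrix.fromBlocks
      ((S ε).submatrix (Subtype.val : {i // p i} → ι) Subtype.val) 0 0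
      ((S ε).submatrix (Subtype.val : {i // ¬p i} → ι) Subtype.val)).submatrix e.symm e.symm := by
    filter_upwards [hSb] with ε h
    ext i j
    obtain ⟨i, rfl⟩ := e.surjective i
    obtain ⟨j, rfl⟩ := e.surjective j
    rw [Matrix.submatrix_apply, e.symm_apply_apply, e.symm_apply_apply]
    rcases i with i | i <;> rcases j with j | j
    · rfl
    · exact h i j fun hij => j.2 (hij.1 i.2)
    · exact h i j fun hij => i.2 (hij.2 j.2)
    · rfl
  let F : ℝ → Matrix ι ι ℝ := fun ε => (Matrix.fromBlocks (U₁ ε) 0 0 (U₂ ε)).submatrix e.symm e.symm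
  have hF : ∀ i j, AnalyticAt ℝ (fun ε => F ε i j) 0 := by
    intro i j
    obtain ⟨i, rfl⟩ := e.surjective i
    obtain ⟨j, rfl⟩ := e.surjective j
    rcases i with i | i <;> rcases j with j | j
    · simpa [F] using hU₁ i j
    · simpa [F] using analyticAt_const
    · simpa [F] using analyticAt_const
    · simpa [F] using hU₂ i j
  have hFo : ∀ᶠ ε in 𝓝 (0 : ℝ), (F ε).transpose * F ε = 1 := by
    filter_upwards [hU₁o, hU₂o] with ε h1 h2
    simp only [F]
    rw [Matrix.transpose_submatrix, Matrix.submatrix_mul_equiv, Matrix.fromBlocks_transpose,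
      Matrix.fromBlocks_multiply]
    simp [h1, h2]
  have hFd : ∀ᶠ ε in 𝓝 (0 : ℝ), (F ε).transpose * S ε * F ε =
      Matrix.diagonal fun i => Sum.elim d₁ d₂ (e.symm i) ε := by
    filter_upwards [hU₁d, hU₂d, hSe] with ε h1 h2 h3
    rw [h3]
    simp only [F]
    rw [Matrix.transpose_submatrix, Matrix.submatrix_mul_equiv, Matrix.submatrix_mul_equiv,
      Matrix.fromBlocks_transpose, Matrix.fromBlocks_multiply, Matrix.fromBlocks_multiply]
    simp only [Matrix.transpose_zero, Matrix.mul_zero, Matrix.zero_mul, add_zero, zero_add, h1, h2]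
    rw [Matrix.fromBlocks_diagonal, Matrix.submatrix_diagonal_equiv]
    congr 1
    funext i
    rcases hi : e.symm i with j | j <;> simp [hi]
  refine ⟨fun ε => T ε * F ε, fun i ε => a ε + ε ^ m * Sum.elim d₁ d₂ (e.symm i) ε,
    analyticAt_mul_apply hT hF, fun i => ?_, ?_, ?_⟩
  · refine ha.add ((analyticAt_id.pow m).mul ?_)
    rcases e.symm i with j | j
    · exact hd₁ j
    · exact hd₂ j
  · filter_upwards [hTo, hFo] with ε h1 h2
    rw [Matrix.transpose_mul, mul_assoc, ← mul_assoc (T ε).transpose, h1, one_mul, h2]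
  · filter_upwards [hTo, hFo, hFd, hAC] with ε h1 h2 h3 h4
    have h5 : (T ε * F ε).transpose * (T ε * F ε) = 1 := by
      rw [Matrix.transpose_mul, mul_assoc, ← mul_assoc (T ε).transpose, h1, one_mul, h2]
    have h6 : (T ε * F ε).transpose * C ε * (T ε * F ε) = (F ε).transpose * S ε * F ε := by
      simp [hSdef, Matrix.transpose_mul, mul_assoc]
    rw [h4, mul_add, add_mul, Matrix.mul_smul, Matrix.mul_smul, Matrix.smul_mul, Matrix.smul_mul,
      mul_one, h5, h6, h3, Matrix.smul_one_eq_diagonal, ← Matrix.diagonal_smul,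
      Matrix.diagonal_add]
    rfl

/-! ### Sorted analytic eigenvalue decompositions and their quadratic forms -/

theorem eventually_le_or_lt {f g : ℝ → ℝ} (hf : AnalyticAt ℝ f 0) (hg : AnalyticAt ℝ g 0) :
    (∀ᶠ ε in 𝓝[>] (0 : ℝ), f ε ≤ g ε) ∨ ∀ᶠ ε in 𝓝[>] (0 : ℝ), g ε < f ε := by
  by_cases htop : analyticOrderAt (g - f) 0 = ⊤
  · left
    rw [analyticOrderAt_eq_top] at htop
    filter_upwards [htop.filter_mono nhdsWithin_le_nhds] with ε h
    exact (sub_eq_zero.1 h).ge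
  · obtain ⟨u, hu, hu0, hfu⟩ := ((hg.sub hf).analyticOrderAt_ne_top).1 htop
    have hfu' := hfu.filter_mono (nhdsWithin_le_nhds (s := Set.Ioi (0 : ℝ)))
    have hpos : ∀ᶠ ε in 𝓝[>] (0 : ℝ), 0 < ε := self_mem_nhdsWithin
    rcases lt_or_gt_of_ne hu0 with h | h
    · right
      filter_upwards [hfu', hpos,
        (hu.continuousAt.eventually_lt_const h).filter_mono nhdsWithin_le_nhds] with ε h1 h2 h3
      have : ε ^ (analyticOrderNatAt (g - f) 0) * u ε < 0 := mul_neg_of_pos_of_neg (pow_pos h2 _) h3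
      simp only [Pi.sub_apply, sub_zero, smul_eq_mul] at h1
      linarith
    · left
      filter_upwards [hfu', hpos,
        (hu.continuousAt.eventually_const_lt h).filter_mono nhdsWithin_le_nhds] with ε h1 h2 h3
      have : 0 < ε ^ (analyticOrderNatAt (g - f) 0) * u ε := mul_pos (pow_pos h2 _) h3
      simp only [Pi.sub_apply, sub_zero, smul_eq_mul] at h1
      linarith

/-- Each pair keeps its order on a right neighbourhood of `0`, so sorting at one sufficiently small
`ε₁` sorts for all smaller `ε`. -/
theorem exists_perm_antitone {n : ℕ} {d : Fin n → ℝ → ℝ} (hd : ∀ k, AnalyticAt ℝ (d k) 0) :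
    ∃ σ : Equiv.Perm (Fin n), ∀ᶠ ε in 𝓝[>] (0 : ℝ), Antitone fun k => d (σ k) ε := by
  have h1 : ∀ᶠ ε₁ in 𝓝[>] (0 : ℝ), ∀ i j, d i ε₁ ≤ d j ε₁ → ∀ᶠ ε in 𝓝[>] (0 : ℝ), d i ε ≤ d j ε := by
    refine eventually_all.2 fun i => eventually_all.2 fun j => ?_
    rcases eventually_le_or_lt (hd i) (hd j) with h | h
    · exact Eventually.of_forall fun _ _ => h
    · filter_upwards [h] with ε h2 h3
      exact absurd h3 h2.not_ge
  obtain ⟨ε₁, hε₁⟩ := h1.exists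
  let σ := Tuple.sort fun k => -d k ε₁
  have hσ : Monotone ((fun k => -d k ε₁) ∘ σ) := Tuple.monotone_sort _
  refine ⟨σ, ?_⟩
  have h2 : ∀ i j, i ≤ j → ∀ᶠ ε in 𝓝[>] (0 : ℝ), d (σ j) ε ≤ d (σ i) ε := fun i j hij =>
    hε₁ _ _ (neg_le_neg_iff.1 (hσ hij))
  have h3 : ∀ᶠ ε in 𝓝[>] (0 : ℝ), ∀ i j, i ≤ j → d (σ j) ε ≤ d (σ i) ε :=
    eventually_all.2 fun i => eventually_all.2 fun j => eventually_imp_distrib_left.2 (h2 i j)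
  filter_upwards [h3] with ε h i j hij
  exact h i j hij

theorem exists_isAnalyticEVD {n : ℕ} {A : ℝ → Matrix (Fin n) (Fin n) ℝ}
    (hA : ∀ i j, AnalyticAt ℝ (fun ε => A ε i j) 0)
    (hsymm : ∀ᶠ ε in 𝓝 (0 : ℝ), (A ε).transpose = A ε) :
    ∃ lam P, IsAnalyticEVD A lam P := by
  obtain ⟨U, d, hU, hd, hUo, hUd⟩ := exists_analytic_diagonalization hA hsymm
  obtain ⟨σ, hσ⟩ := exists_perm_antitone hd
  have hdot : ∀ᶠ ε in 𝓝 (0 : ℝ), ∀ j k,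
      (fun i => U ε i j) ⬝ᵥ (fun i => U ε i k) = (1 : Matrix (Fin n) (Fin n) ℝ) j k := by
    filter_upwards [hUo] with ε h j k
    rw [← h]
    rfl
  refine ⟨fun k => d (σ k),
    fun k ε => Matrix.vecMulVec (fun i => U ε i (σ k)) fun i => U ε i (σ k),
    fun k => hd _, fun k i j => ?_, ?_, ?_, ?_, hσ⟩
  · simp only [Matrix.vecMulVec_apply]
    exact (hU i _).mul (hU j _)
  · filter_upwards [hdot] with ε h k
    exact ⟨_, by simp [h], rfl⟩
  · filter_upwards [hdot] with ε h j k hjk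
    rw [Matrix.vecMulVec_mul_vecMulVec, h]
    ext a b
    simp [hjk, Matrix.vecMulVec_apply]
  · filter_upwards [hUo, hUd] with ε h1 h2
    have h3 : U ε * (U ε).transpose = 1 := mul_eq_one_comm.1 h1
    have h4 : A ε = U ε * (Matrix.diagonal fun i => d i ε) * (U ε).transpose := by
      rw [← h2]
      simp only [mul_assoc, h3, mul_one]
      rw [← mul_assoc, h3, one_mul]
    rw [Equiv.sum_comp σ fun k => d k ε • Matrix.vecMulVec (fun i => U ε i k) fun i => U ε i k]
    ext i j
    rw [h4, Matrix.mul_apply, Matrix.sum_apply]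
    refine Finset.sum_congr rfl fun k _ => ?_
    simp [Matrix.mul_diagonal, Matrix.vecMulVec_apply]
    ring

/-- Orthonormal eigenvectors of an eigenvalue decomposition. -/
theorem IsAnalyticEVD.eventually_exists_eigenvectors {n : ℕ} {A : ℝ → Matrix (Fin n) (Fin n) ℝ}
    {lam : Fin n → ℝ → ℝ} {P : Fin n → ℝ → Matrix (Fin n) (Fin n) ℝ} (h : IsAnalyticEVD A lam P) :
    ∀ᶠ ε in 𝓝 (0 : ℝ), ∃ U : Matrix (Fin n) (Fin n) ℝ, U.transpose * U = 1 ∧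
      (∀ k, P k ε = Matrix.vecMulVec (fun i => U i k) fun i => U i k) ∧
      A ε = U * (Matrix.diagonal fun k => lam k ε) * U.transpose := by
  filter_upwards [h.rank_one, h.orthogonal, h.decomposition] with ε h1 h2 h3
  choose v hv hP using h1
  refine ⟨Matrix.of fun i k => v k i, ?_, hP, ?_⟩
  · ext j k
    change v j ⬝ᵥ v k = _
    by_cases hjk : j = k
    · subst hjk
      simp [hv]
    · have h4 := h2 j k hjk
      rw [hP, hP, Matrix.vecMulVec_mul_vecMulVec] at h4
      -- Testing `P_j P_k = 0` against the two unit vectors leaves their inner product.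
      have h5 : v j ⬝ᵥ (Matrix.vecMulVec (v j) ((v j ⬝ᵥ v k) • v k)).mulVec (v k) = 0 := by
        rw [h4]; simp
      rw [Matrix.vecMulVec_mulVec] at h5
      simpa [hv, Matrix.one_apply, hjk] using h5
  · rw [h3]
    ext i j
    rw [Matrix.mul_apply, Matrix.sum_apply]
    refine Finset.sum_congr rfl fun k _ => ?_
    simp [Matrix.mul_diagonal, hP, Matrix.vecMulVec_apply]
    ring

theorem IsAnalyticEVD.eventually_det {n : ℕ} {A : ℝ → Matrix (Fin n) (Fin n) ℝ}
    {lam : Fin n → ℝ → ℝ} {P : Fin n → ℝ → Matrix (Fin n) (Fin n) ℝ} (h : IsAnalyticEVD A lam P) :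
    ∀ᶠ ε in 𝓝 (0 : ℝ), ∀ z : ℝ,
      (z • (1 : Matrix (Fin n) (Fin n) ℝ) - A ε).det = ∏ k, (z - lam k ε) := by
  filter_upwards [h.eventually_exists_eigenvectors] with ε ⟨U, hU, _, hA⟩ z
  have hU' : U * U.transpose = 1 := mul_eq_one_comm.1 hU
  have h1 : z • (1 : Matrix (Fin n) (Fin n) ℝ) - A ε =
      U * (Matrix.diagonal fun k => z - lam k ε) * U.transpose := by
    have : (Matrix.diagonal fun k => z - lam k ε) =
        z • (1 : Matrix (Fin n) (Fin n) ℝ) - Matrix.diagonal fun k => lam k ε := by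
      rw [Matrix.smul_one_eq_diagonal, Matrix.diagonal_sub]
    rw [this, mul_sub, sub_mul, ← hA, Matrix.mul_smul, mul_one, Matrix.smul_mul, hU']
  rw [h1, Matrix.det_mul, Matrix.det_mul, mul_right_comm, ← Matrix.det_mul, hU', Matrix.det_one,
    one_mul, Matrix.det_diagonal]

/-- The quadratic form of `A` in terms of eigenvalues and eigenvectors. -/
theorem dotProduct_mulVec_eq_sum {n : ℕ} {A U : Matrix (Fin n) (Fin n) ℝ} {d : Fin n → ℝ}
    (hA : A = U * Matrix.diagonal d * U.transpose) (q : Fin n → ℝ) :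
    q ⬝ᵥ A.mulVec q = ∑ k, d k * ((fun i => U i k) ⬝ᵥ q) ^ 2 := by
  have h1 : q ⬝ᵥ A.mulVec q = U.transpose.mulVec q ⬝ᵥ (Matrix.diagonal d).mulVec (U.transpose.mulVec q) := by
    rw [hA, ← Matrix.mulVec_mulVec, ← Matrix.mulVec_mulVec, Matrix.dotProduct_mulVec,
      Matrix.mulVec_transpose]
  rw [h1]
  simp only [dotProduct, Matrix.mulVec_diagonal]
  refine Finset.sum_congr rfl fun k _ => ?_
  change U.transpose.mulVec q k * _ = d k * (U.transpose.mulVec q k) ^ 2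
  ring

section
variable {n : ℕ} {A : ℝ → Matrix (Fin n) (Fin n) ℝ} {lam : Fin n → ℝ → ℝ}
  {P : Fin n → ℝ → Matrix (Fin n) (Fin n) ℝ}

theorem IsAnalyticEVD.eventually_nonneg (h : IsAnalyticEVD A lam P)
    (hpsd : ∀ᶠ ε in 𝓝[>] (0 : ℝ), (A ε).PosSemidef) :
    ∀ᶠ ε in 𝓝[>] (0 : ℝ), ∀ k, 0 ≤ lam k ε := by
  filter_upwards [h.eventually_exists_eigenvectors.filter_mono nhdsWithin_le_nhds, hpsd] with
    ε ⟨U, hU, _, hA⟩ hp k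
  have h1 := hp.dotProduct_mulVec_nonneg fun i => U i k
  have h2 : ∀ j, (fun i => U i j) ⬝ᵥ (fun i => U i k) = (1 : Matrix (Fin n) (Fin n) ℝ) j k :=
    fun j => by rw [← hU]; rfl
  rw [star_trivial, dotProduct_mulVec_eq_sum hA] at h1
  simpa [h2, Matrix.one_apply] using h1

/-- All eigenvalues are nonnegative, so a single spectral summand is dominated by the whole form.
This is what constrains the limiting eigenvectors. -/
theorem IsAnalyticEVD.eventually_mul_le (h : IsAnalyticEVD A lam P)
    (hpsd : ∀ᶠ ε in 𝓝[>] (0 : ℝ), (A ε).PosSemidef) :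
    ∀ᶠ ε in 𝓝[>] (0 : ℝ), ∀ k q,
      lam k ε * (q ⬝ᵥ (P k ε).mulVec q) ≤ q ⬝ᵥ (A ε).mulVec q := by
  filter_upwards [h.eventually_exists_eigenvectors.filter_mono nhdsWithin_le_nhds,
    h.eventually_nonneg hpsd] with ε ⟨U, hU, hP, hA⟩ hp k q
  rw [dotProduct_mulVec_eq_sum hA]
  have h1 : q ⬝ᵥ (P k ε).mulVec q = ((fun i => U i k) ⬝ᵥ q) ^ 2 := by
    rw [hP, Matrix.vecMulVec_mulVec]
    simp [dotProduct_comm q, sq]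
  rw [h1]
  exact Finset.single_le_sum (f := fun k => lam k ε * ((fun i => U i k) ⬝ᵥ q) ^ 2)
    (fun i _ => mul_nonneg (hp i) (sq_nonneg _)) (Finset.mem_univ k)

/-- A rank-one projector determines its unit vector up to sign, and signs do not affect
orthonormality. -/
theorem IsAnalyticEVD.orthonormal_limiting (h : IsAnalyticEVD A lam P) {p : Fin n → Fin n → ℝ}
    (hp : IsLimitingEigenvectors P p) (j k : Fin n) :
    p j ⬝ᵥ p k = (1 : Matrix (Fin n) (Fin n) ℝ) j k := by
  obtain ⟨U, hU, hP, -⟩ := h.eventually_exists_eigenvectors.self_of_nhds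
  have h1 : ∀ j k, (fun i => U i j) ⬝ᵥ (fun i => U i k) = (1 : Matrix (Fin n) (Fin n) ℝ) j k :=
    fun j k => by rw [← hU]; rfl
  have h2 : ∀ k, p k = (fun i => U i k) ∨ p k = -fun i => U i k := by
    intro k
    have h3 : Matrix.vecMulVec (p k) (p k) = Matrix.vecMulVec (fun i => U i k) fun i => U i k := by
      rw [← hP, hp k]
    set u := fun i => U i k
    have h4 : u ⬝ᵥ u = 1 := by simp [u, h1]
    have h5 : (p k ⬝ᵥ u) • p k = u := by
      have := congrArg (fun M => M.mulVec u) h3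
      simpa [Matrix.vecMulVec_mulVec, h4] using this
    have h6 : (p k ⬝ᵥ u) * (p k ⬝ᵥ u) = 1 := by
      have := congrArg (fun w => w ⬝ᵥ u) h5
      simpa [smul_dotProduct, h4] using this
    rcases mul_self_eq_one_iff.1 h6 with h7 | h7
    · left; rw [← h5, h7, one_smul]
    · right; rw [← h5, h7, neg_one_smul, neg_neg]
  by_cases hjk : j = k
  · subst hjk
    rcases h2 j with h | h <;> simp [h, h1]
  · rcases h2 j with h | h <;> rcases h2 k with h' | h' <;> simp [h, h', h1, hjk]
end

/-! ### Taylor expansion of the kernel and its Wronskian -/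

section
variable {a : ℝ} {f : ℝ → ℝ} {N : ℕ}

/-- Peano's form of the remainder at order `L`, with the last term of the Taylor polynomial moved to
the limit. -/
theorem tendsto_taylor_quotient (ha : 0 < a)
    (hf : ContDiffOn ℝ (N : WithTop ℕ∞) f (Set.Ioo (-a) a)) {L : ℕ} (hL : L ≤ N) (d : ℝ) :
    Tendsto (fun ε => (f (ε * d) - ∑ m ∈ Finset.range L, taylorCoeff f m * d ^ m * ε ^ m) / ε ^ L)
      (𝓝[≠] 0) (𝓝 (taylorCoeff f L * d ^ L)) := by
  have h0 : (0 : ℝ) ∈ Set.Ioo (-a) a := ⟨neg_lt_zero.2 ha, ha⟩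
  have h1 := taylor_isLittleO (convex_Ioo (-a) a) h0
    (hf.of_le (m := (L : WithTop ℕ∞)) (by exact_mod_cast hL))
  rw [isOpen_Ioo.nhdsWithin_eq h0] at h1
  have h2 : ∀ t, taylorWithinEval f L (Set.Ioo (-a) a) 0 t =
      ∑ m ∈ Finset.range (L + 1), taylorCoeff f m * t ^ m := by
    intro t
    rw [taylor_within_apply]
    refine Finset.sum_congr rfl fun k _ => ?_
    rw [iteratedDerivWithin_of_isOpen isOpen_Ioo h0, taylorCoeff, sub_zero, smul_eq_mul]
    ring
  simp only [h2, sub_zero] at h1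
  have ht : Tendsto (fun ε : ℝ => ε * d) (𝓝 0) (𝓝 0) := by
    have := (continuous_mul_const d).tendsto (0 : ℝ)
    rwa [zero_mul] at this
  have h3 := (h1.comp_tendsto ht).trans_isBigO
    (show ((fun t : ℝ => t ^ L) ∘ fun ε : ℝ => ε * d) =O[𝓝 0] fun ε : ℝ => ε ^ L from by
      refine IsBigO.of_bound (‖d ^ L‖) (Eventually.of_forall fun ε => ?_)
      simp [mul_pow, mul_comm])
  have h4 := ((h3.mono (nhdsWithin_le_nhds (s := {0}ᶜ))).tendsto_div_nhds_zero).add_const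
    (taylorCoeff f L * d ^ L)
  rw [zero_add] at h4
  refine h4.congr' ?_
  filter_upwards [self_mem_nhdsWithin] with ε hε
  have hε' : ε ^ L ≠ 0 := pow_ne_zero _ hε
  have hs : ∑ m ∈ Finset.range L, taylorCoeff f m * (ε ^ m * d ^ m) =
      ∑ m ∈ Finset.range L, taylorCoeff f m * d ^ m * ε ^ m :=
    Finset.sum_congr rfl fun m _ => by ring
  simp only [Function.comp_apply, Finset.sum_range_succ, mul_pow, hs]
  field_simp
  ring

theorem hasDerivAt_iteratedDeriv (hf : ContDiffOn ℝ (N : WithTop ℕ∞) f (Set.Ioo (-a) a)) {m : ℕ}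
    (hm : m < N) {t : ℝ} (ht : t ∈ Set.Ioo (-a) a) :
    HasDerivAt (iteratedDeriv m f) (iteratedDeriv (m + 1) f t) t := by
  rw [iteratedDeriv_succ]
  refine DifferentiableAt.hasDerivAt ?_
  have h1 := (hf.differentiableOn_iteratedDerivWithin (m := m) (by exact_mod_cast hm)
    isOpen_Ioo.uniqueDiffOn).congr fun y hy => (iteratedDerivWithin_of_isOpen isOpen_Ioo hy).symm
  exact h1.differentiableAt (isOpen_Ioo.mem_nhds ht)

/-- Derivatives of `f ∘ |·|` when the odd derivatives of `f` at `0` vanish. -/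
theorem iteratedDeriv_comp_abs (hf : ContDiffOn ℝ (N : WithTop ℕ∞) f (Set.Ioo (-a) a)) {M : ℕ}
    (hMN : M < N) (hodd : ∀ m ≤ M, (-1) ^ m * iteratedDeriv m f 0 = iteratedDeriv m f 0) {m : ℕ}
    (hm : m ≤ M) : ∀ t ∈ Set.Ioo (-a) a, iteratedDeriv m (fun t => f |t|) t =
      if 0 ≤ t then iteratedDeriv m f t else (-1) ^ m * iteratedDeriv m f (-t) := by
  induction m with
  | zero =>
    intro t _
    split_ifs with h
    · simp [abs_of_nonneg h]
    · simp [abs_of_neg (not_le.1 h)]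
  | succ m ih =>
    have ih := ih (by omega)
    intro t ht
    have hnhds := isOpen_Ioo.mem_nhds ht
    rcases lt_trichotomy t 0 with h | rfl | h
    · have h1 : iteratedDeriv m (fun t => f |t|) =ᶠ[𝓝 t] fun t => (-1) ^ m * iteratedDeriv m f (-t) := by
        filter_upwards [hnhds, Iio_mem_nhds h] with u hu hu0
        rw [ih u hu, if_neg (not_le.2 hu0)]
      rw [iteratedDeriv_succ, h1.deriv_eq, if_neg (not_le.2 h), deriv_const_mul_field, deriv_comp_neg,
        iteratedDeriv_succ, pow_succ]
      ring
    · rw [if_pos le_rfl, iteratedDeriv_succ]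
      -- At the gluing point the one-sided derivatives are `f^(m+1)(0)` and `(-1)^(m+1) f^(m+1)(0)`;
      -- they agree by `hodd`.
      have hf0 := hasDerivAt_iteratedDeriv hf (show m < N by omega) ht
      refine HasDerivAt.deriv ?_
      have hr : HasDerivWithinAt (iteratedDeriv m fun t => f |t|) (iteratedDeriv (m + 1) f 0)
          (Set.Ici 0) 0 := by
        refine hf0.hasDerivWithinAt.congr_of_eventuallyEq ?_ (by rw [ih 0 ht, if_pos le_rfl])
        filter_upwards [nhdsWithin_le_nhds hnhds, self_mem_nhdsWithin] with u hu hu0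
        rw [ih u hu, if_pos (show 0 ≤ u from hu0)]
      have hl : HasDerivWithinAt (iteratedDeriv m fun t => f |t|) (iteratedDeriv (m + 1) f 0)
          (Set.Iic 0) 0 := by
        have h1 : HasDerivAt (fun t => (-1) ^ m * iteratedDeriv m f (-t))
            (iteratedDeriv (m + 1) f 0) 0 := by
          have h2 : HasDerivAt (iteratedDeriv m f) (iteratedDeriv (m + 1) f 0) (-0) := by
            rwa [neg_zero]
          have h3 := (h2.comp (0 : ℝ) (hasDerivAt_neg (0 : ℝ))).const_mul ((-1 : ℝ) ^ m)
          have e : (-1 : ℝ) ^ m * (iteratedDeriv (m + 1) f 0 * -1) = iteratedDeriv (m + 1) f 0 := by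
            have h4 := hodd (m + 1) hm
            rw [pow_succ] at h4
            linarith
          rw [e] at h3
          exact h3
        refine h1.hasDerivWithinAt.congr_of_eventuallyEq ?_ ?_
        · filter_upwards [nhdsWithin_le_nhds hnhds, self_mem_nhdsWithin] with u hu hu0
          rcases eq_or_lt_of_le (show u ≤ 0 from hu0) with rfl | h
          · rw [ih 0 hu, if_pos le_rfl, neg_zero, hodd m (by omega)]
          · rw [ih u hu, if_neg (not_le.2 h)]
        · rw [ih 0 ht, if_pos le_rfl, neg_zero, hodd m (by omega)]
      have h := hl.union hr
      rwa [Set.Iic_union_Ici, hasDerivWithinAt_univ] at h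
    · have h1 : iteratedDeriv m (fun t => f |t|) =ᶠ[𝓝 t] iteratedDeriv m f := by
        filter_upwards [hnhds, Ioi_mem_nhds h] with u hu hu0
        rw [ih u hu, if_pos (le_of_lt hu0)]
      rw [iteratedDeriv_succ, h1.deriv_eq, if_pos h.le, iteratedDeriv_succ]
end

theorem mixedDeriv_radialKernel (f : ℝ → ℝ) (i j : ℕ) :
    mixedDeriv (radialKernel f) i j = (-1) ^ j * iteratedDeriv (i + j) (fun t => f |t|) 0 := by
  have h1 : (fun x => iteratedDeriv j (fun y => radialKernel f x y) 0) =
      fun x => (-1) ^ j * iteratedDeriv j (fun t => f |t|) x := by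
    funext x
    have := congrFun (iteratedDeriv_comp_const_sub j (fun t => f |t|) x) 0
    simpa [radialKernel] using this
  rw [mixedDeriv, h1, iteratedDeriv_const_mul_field]
  simp only [iteratedDeriv_eq_iterate, Function.iterate_add_apply]

section
variable {a : ℝ} {r : ℕ} {f : ℝ → ℝ}

theorem HasSmoothnessOrder.taylorCoeff_odd (hf : HasSmoothnessOrder a r f) {m : ℕ}
    (hm : m + 2 ≤ 2 * r) (hodd : Odd m) : taylorCoeff f m = 0 := by
  obtain ⟨k, rfl⟩ := hodd
  have := hf.lower_eq_zero (k + 1) (by omega) (by omega)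
  rw [show 2 * (k + 1) - 1 = 2 * k + 1 by omega] at this
  simp [taylorCoeff, this]

theorem HasSmoothnessOrder.neg_one_pow_mul_taylorCoeff (hf : HasSmoothnessOrder a r f) {m : ℕ}
    (hm : m + 2 ≤ 2 * r) : (-1) ^ m * taylorCoeff f m = taylorCoeff f m := by
  rcases Nat.even_or_odd m with h | h
  · rw [h.neg_one_pow, one_mul]
  · rw [hf.taylorCoeff_odd hm h, mul_zero]

/-- Up to order `2r - 2` the odd derivatives of `f` vanish at `0`, so `f` and `f ∘ |·|` have the
same derivatives there. The binomial coefficient is `(i + j)! / (i! j!)`. -/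
theorem HasSmoothnessOrder.wronskian_apply (hf : HasSmoothnessOrder a r f) (ha : 0 < a) {s : ℕ}
    (i j : Fin s) (hij : (i : ℕ) + j + 2 ≤ 2 * r) :
    wronskian (radialKernel f) s i j =
      (-1) ^ (j : ℕ) * ((i + j : ℕ).choose i : ℝ) * taylorCoeff f (i + j) := by
  have h1 : iteratedDeriv (i + j : ℕ) (fun t => f |t|) 0 = iteratedDeriv (i + j : ℕ) f 0 := by
    have h2 := iteratedDeriv_comp_abs hf.contDiffOn (M := 2 * r - 2) (by have := hf.pos; omega)
      (fun m hm => by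
        have h3 := hf.neg_one_pow_mul_taylorCoeff (m := m) (by have := hf.pos; omega)
        have h4 : (m.factorial : ℝ) ≠ 0 := by positivity
        rw [taylorCoeff, ← mul_div_assoc, div_left_inj' h4] at h3
        exact h3) (m := i + j) (by omega) 0 ⟨by linarith, by linarith⟩
    rw [h2, if_pos le_rfl]
  rw [wronskian, Matrix.of_apply, mixedDeriv_radialKernel, h1, taylorCoeff,
    Nat.cast_add_choose]
  have h4 : ((i + j : ℕ).factorial : ℝ) ≠ 0 := by positivity
  field_simp
end

/-! ### Cancellation in the scaled kernel matrix against vectors with vanishing moments -/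

/-- The coefficient of `ε ^ m` in the expansion of the scaled kernel matrix. -/
noncomputable def taylorMatrix {n : ℕ} (f : ℝ → ℝ) (x : Fin n → ℝ) (m : ℕ) :
    Matrix (Fin n) (Fin n) ℝ :=
  taylorCoeff f m • distPow x m

/-- The remainder of order `L` of the scaled kernel matrix, divided by `ε ^ L`. -/
noncomputable def kernelRemainder {n : ℕ} (f : ℝ → ℝ) (x : Fin n → ℝ) (L : ℕ) (ε : ℝ) :
    Matrix (Fin n) (Fin n) ℝ :=
  Matrix.of fun i j => (f (ε * |x i - x j|) -
    ∑ m ∈ Finset.range L, taylorCoeff f m * |x i - x j| ^ m * ε ^ m) / ε ^ L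

theorem scaledKernelMatrix_eq {n : ℕ} (f : ℝ → ℝ) (x : Fin n → ℝ) (L : ℕ) {ε : ℝ} (hε : ε ≠ 0) :
    scaledKernelMatrix f x ε =
      (∑ m ∈ Finset.range L, ε ^ m • taylorMatrix f x m) + ε ^ L • kernelRemainder f x L ε := by
  ext i j
  have : ε ^ L ≠ 0 := pow_ne_zero _ hε
  simp only [scaledKernelMatrix, kernelRemainder, taylorMatrix, distPow, Matrix.add_apply,
    Matrix.sum_apply, Matrix.smul_apply, Matrix.of_apply, smul_eq_mul, mul_div_cancel₀ _ this]
  rw [show ∑ m ∈ Finset.range L, ε ^ m * (taylorCoeff f m * |x i - x j| ^ m) =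
    ∑ m ∈ Finset.range L, taylorCoeff f m * |x i - x j| ^ m * ε ^ m from
    Finset.sum_congr rfl fun m _ => by ring]
  field_simp
  ring

section
variable {n r : ℕ} {a : ℝ} {f : ℝ → ℝ} {x : Fin n → ℝ}

theorem HasSmoothnessOrder.tendsto_kernelRemainder (hf : HasSmoothnessOrder a r f) (ha : 0 < a)
    {L : ℕ} (hL : L ≤ 2 * r) (i j : Fin n) :
    Tendsto (fun ε => kernelRemainder f x L ε i j) (𝓝[≠] 0) (𝓝 (taylorMatrix f x L i j)) :=
  tendsto_taylor_quotient (mul_pos two_pos ha) hf.contDiffOn hL _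

theorem HasSmoothnessOrder.taylorMatrix_apply (hf : HasSmoothnessOrder a r f) {m : ℕ}
    (hm : m + 2 ≤ 2 * r) (i j : Fin n) :
    taylorMatrix f x m i j = taylorCoeff f m * (x i - x j) ^ m := by
  rcases Nat.even_or_odd m with h | h
  · simp [taylorMatrix, distPow, h.pow_abs]
  · simp [taylorMatrix, hf.taylorCoeff_odd hm h]

/-- The binomial theorem for `(x_i - x_j)^m`; in this range odd `m` has coefficient zero, so
absolute values disappear. -/
theorem HasSmoothnessOrder.dotProduct_taylorMatrix (hf : HasSmoothnessOrder a r f) {m : ℕ}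
    (hm : m + 2 ≤ 2 * r) (p q : Fin n → ℝ) :
    p ⬝ᵥ (taylorMatrix f x m).mulVec q = taylorCoeff f m *
      ∑ c ∈ Finset.HasAntidiagonal.antidiagonal m, (m.choose c.1 : ℝ) * (-1) ^ c.2 *
        ((p ⬝ᵥ fun k => x k ^ c.1) * (q ⬝ᵥ fun k => x k ^ c.2)) := by
  have h1 : ∀ i j, (x i - x j) ^ m = ∑ c ∈ Finset.HasAntidiagonal.antidiagonal m,
      (m.choose c.1 : ℝ) * (-1) ^ c.2 * (x i ^ c.1 * x j ^ c.2) := by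
    intro i j
    rw [sub_eq_add_neg, (Commute.all _ _).add_pow']
    refine Finset.sum_congr rfl fun c _ => ?_
    rw [neg_pow, nsmul_eq_mul]
    ring
  have h2 : p ⬝ᵥ (taylorMatrix f x m).mulVec q =
      ∑ i, ∑ j, p i * (taylorCoeff f m * (x i - x j) ^ m * q j) := by
    simp only [dotProduct, Matrix.mulVec, hf.taylorMatrix_apply hm, Finset.mul_sum]
  rw [h2, Finset.mul_sum]
  simp only [dotProduct, h1, Finset.mul_sum, Finset.sum_mul]
  rw [Finset.sum_comm]
  conv_rhs => rw [Finset.sum_comm]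
  refine Finset.sum_congr rfl fun i _ => ?_
  conv_rhs => rw [Finset.sum_comm]
  exact Finset.sum_congr rfl fun j _ => Finset.sum_congr rfl fun c _ => by ring

variable {p q : Fin n → ℝ} {i j : ℕ}

/-- If `b + c < i + j`, then `b < i` or `c < j`, so every binomial term contains a vanishing moment.
In degree exactly `i + j` only the term `(i, j)` survives. -/
theorem HasSmoothnessOrder.dotProduct_taylorMatrix_eq_zero (hf : HasSmoothnessOrder a r f)
    (hp : ∀ b < i, (p ⬝ᵥ fun k => x k ^ b) = 0) (hq : ∀ b < j, (q ⬝ᵥ fun k => x k ^ b) = 0)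
    {m : ℕ} (hm : m + 2 ≤ 2 * r) (hmij : m < i + j) :
    p ⬝ᵥ (taylorMatrix f x m).mulVec q = 0 := by
  rw [hf.dotProduct_taylorMatrix hm, Finset.sum_eq_zero, mul_zero]
  rintro ⟨b, c⟩ hc
  rw [Finset.HasAntidiagonal.mem_antidiagonal] at hc
  by_cases h : b < i
  · simp [hp b h]
  · simp [hq c (by simp at hc; omega)]

theorem HasSmoothnessOrder.dotProduct_taylorMatrix_add (hf : HasSmoothnessOrder a r f)
    (hp : ∀ b < i, (p ⬝ᵥ fun k => x k ^ b) = 0) (hq : ∀ b < j, (q ⬝ᵥ fun k => x k ^ b) = 0)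
    (hm : i + j + 2 ≤ 2 * r) :
    p ⬝ᵥ (taylorMatrix f x (i + j)).mulVec q = (-1) ^ j * ((i + j).choose i : ℝ) *
      taylorCoeff f (i + j) * ((p ⬝ᵥ fun k => x k ^ i) * (q ⬝ᵥ fun k => x k ^ j)) := by
  rw [hf.dotProduct_taylorMatrix hm, Finset.sum_eq_single (i, j)]
  · ring
  · rintro ⟨b, c⟩ hc hne
    rw [Finset.HasAntidiagonal.mem_antidiagonal] at hc
    simp only at hc
    by_cases h : b < i
    · simp [hp b h]
    · have : c < j := by
        by_contra hcj
        exact hne (Prod.ext (by simp; omega) (by simp; omega))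
      simp [hq c this]
  · intro h
    simp at h

theorem HasSmoothnessOrder.dotProduct_scaledKernelMatrix (hf : HasSmoothnessOrder a r f)
    (hp : ∀ b < i, (p ⬝ᵥ fun k => x k ^ b) = 0) (hq : ∀ b < j, (q ⬝ᵥ fun k => x k ^ b) = 0)
    {L : ℕ} (hL : L ≤ i + j) (hLr : L + 1 ≤ 2 * r) {ε : ℝ} (hε : ε ≠ 0) :
    p ⬝ᵥ (scaledKernelMatrix f x ε).mulVec q =
      ε ^ L * (p ⬝ᵥ (kernelRemainder f x L ε).mulVec q) := by
  rw [scaledKernelMatrix_eq f x L hε, Matrix.add_mulVec, dotProduct_add, Matrix.smul_mulVec,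
    dotProduct_smul, smul_eq_mul, Matrix.sum_mulVec, dotProduct_sum, Finset.sum_eq_zero, zero_add]
  intro m hm
  rw [Finset.mem_range] at hm
  rw [Matrix.smul_mulVec, dotProduct_smul,
    -- Since `L ≤ 2r - 1`, the terms with `m < L` have degree at most `2r - 2`, where the expansion
    -- is polynomial.
    hf.dotProduct_taylorMatrix_eq_zero hp hq (by omega) (by omega), smul_zero]

theorem HasSmoothnessOrder.tendsto_dotProduct_scaledKernelMatrix (hf : HasSmoothnessOrder a r f)
    (ha : 0 < a) (hp : ∀ b < i, (p ⬝ᵥ fun k => x k ^ b) = 0)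
    (hq : ∀ b < j, (q ⬝ᵥ fun k => x k ^ b) = 0)
    {L : ℕ} (hL : L ≤ i + j) (hLr : L + 1 ≤ 2 * r) :
    Tendsto (fun ε => p ⬝ᵥ (scaledKernelMatrix f x ε).mulVec q / ε ^ L) (𝓝[≠] 0)
      (𝓝 (p ⬝ᵥ (taylorMatrix f x L).mulVec q)) := by
  have h1 : Tendsto (fun ε => p ⬝ᵥ (kernelRemainder f x L ε).mulVec q) (𝓝[≠] 0)
      (𝓝 (p ⬝ᵥ (taylorMatrix f x L).mulVec q)) := by
    simp only [dotProduct, Matrix.mulVec]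
    exact tendsto_finsetSum _ fun k _ => (tendsto_finsetSum _ fun l _ =>
      (hf.tendsto_kernelRemainder ha (by omega) k l).mul_const _).const_mul _
  refine h1.congr' ?_
  filter_upwards [self_mem_nhdsWithin] with ε hε
  rw [hf.dotProduct_scaledKernelMatrix hp hq hL hLr hε, mul_div_cancel_left₀ _ (pow_ne_zero _ hε)]

end

/-! ### Orders of the eigenvalues -/

theorem HasMainTerm.tendsto {g : ℝ → ℝ} {L : ℕ} {c : ℝ} (h : HasMainTerm g L c) :
    Tendsto (fun ε => g ε / ε ^ L) (𝓝[≠] 0) (𝓝 c) := by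
  obtain ⟨u, hu, hg⟩ := h
  have h1 : Tendsto u (𝓝 0) (𝓝 0) := hu.trans_tendsto tendsto_id
  have h2 : Tendsto (fun ε => c + u ε) (𝓝[≠] 0) (𝓝 c) := by
    have := (h1.mono_left (nhdsWithin_le_nhds (s := {0}ᶜ))).const_add c
    rwa [add_zero] at this
  refine h2.congr' ?_
  filter_upwards [hg.filter_mono nhdsWithin_le_nhds, self_mem_nhdsWithin] with ε h3 h4
  rw [h3, mul_div_cancel_left₀ _ (pow_ne_zero _ h4)]

/-- A one-sided bound already forces the order of vanishing of an analytic function to be at least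
`L`; the expansion is then two-sided. -/
theorem exists_hasMainTerm {g : ℝ → ℝ} (hg : AnalyticAt ℝ g 0) {L : ℕ} {C : ℝ}
    (hC : ∀ᶠ ε in 𝓝[>] (0 : ℝ), |g ε| ≤ C * ε ^ L) : ∃ c, HasMainTerm g L c := by
  have hpos : ∀ᶠ ε in 𝓝[>] (0 : ℝ), 0 < ε := self_mem_nhdsWithin
  have hord : (L : ℕ∞) ≤ analyticOrderAt g 0 := by
    by_contra! hlt
    obtain ⟨m, hm⟩ := ENat.ne_top_iff_exists.1 hlt.ne_top
    rw [← hm, Nat.cast_lt] at hlt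
    obtain ⟨u, hu, hu0, hgu⟩ := (hg.analyticOrderAt_eq_natCast (n := m)).1 hm.symm
    refine hu0 (abs_eq_zero.1 (le_antisymm ?_ (abs_nonneg _)))
    have h1 : Tendsto (fun ε => |u ε|) (𝓝[>] 0) (𝓝 |u 0|) :=
      (hu.continuousAt.abs.tendsto).mono_left nhdsWithin_le_nhds
    have h2 : Tendsto (fun ε : ℝ => C * ε ^ (L - m)) (𝓝[>] 0) (𝓝 0) := by
      have h3 : Continuous fun ε : ℝ => C * ε ^ (L - m) := by fun_prop
      have h4 := (h3.tendsto 0).mono_left (nhdsWithin_le_nhds (s := Set.Ioi 0))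
      simpa [zero_pow (Nat.sub_ne_zero_of_lt hlt)] using h4
    refine le_of_tendsto_of_tendsto h1 h2 ?_
    filter_upwards [hC, hgu.filter_mono nhdsWithin_le_nhds, hpos] with ε h3 h4 h5
    have h6 : 0 < ε ^ m := pow_pos h5 m
    rw [h4, sub_zero, smul_eq_mul, abs_mul, abs_of_pos h6,
      show L = m + (L - m) by omega, pow_add] at h3
    have h7 : ε ^ m * |u ε| ≤ ε ^ m * (C * ε ^ (L - m)) := by
      linarith
    exact le_of_mul_le_mul_left h7 h6
  obtain ⟨u, hu, hgu⟩ := (natCast_le_analyticOrderAt hg).1 hord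
  refine ⟨u 0, fun ε => u ε - u 0, ?_, ?_⟩
  · simpa using hu.differentiableAt.isBigO_sub
  · filter_upwards [hgu] with ε h
    rw [h]
    simp

theorem abs_dotProduct_mulVec_le {n : ℕ} {H : Matrix (Fin n) (Fin n) ℝ} {B : ℝ}
    (hB : ∀ i j, |H i j| ≤ B) (u : Fin n → ℝ) : |u ⬝ᵥ H.mulVec u| ≤ B * n * (u ⬝ᵥ u) := by
  have h1 : u ⬝ᵥ H.mulVec u = ∑ i, ∑ j, u i * (H i j * u j) := by
    simp only [dotProduct, Matrix.mulVec, Finset.mul_sum]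
  have h2 : ∑ i : Fin n, ∑ j : Fin n, B * ((u i * u i + u j * u j) / 2) = B * n * (u ⬝ᵥ u) := by
    simp only [dotProduct, ← Finset.mul_sum, ← Finset.sum_div, Finset.sum_add_distrib,
      Finset.sum_const, Finset.card_univ, Fintype.card_fin, nsmul_eq_mul]
    rw [show ∑ i, u i * (n * u i) = n * ∑ i, u i * u i by
      rw [Finset.mul_sum]; exact Finset.sum_congr rfl fun i _ => by ring]
    ring
  rw [h1, ← h2]
  refine (Finset.abs_sum_le_sum_abs _ _).trans (Finset.sum_le_sum fun i _ =>
    (Finset.abs_sum_le_sum_abs _ _).trans (Finset.sum_le_sum fun j _ => ?_))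
  rw [abs_mul, abs_mul]
  have h3 : |u i| * |u j| ≤ (u i * u i + u j * u j) / 2 := by
    nlinarith [sq_nonneg (|u i| - |u j|), abs_mul_abs_self (u i), abs_mul_abs_self (u j)]
  calc |u i| * (|H i j| * |u j|) = |H i j| * (|u i| * |u j|) := by ring
    _ ≤ B * ((u i * u i + u j * u j) / 2) :=
      mul_le_mul (hB i j) h3 (by positivity) ((abs_nonneg _).trans (hB i j))

/-- A nonzero combination of the first `k + 1` columns of `U` that is orthogonal to `k' ≤ k` given
vectors. -/
theorem exists_combination_orthogonal {n : ℕ} (U : Matrix (Fin n) (Fin n) ℝ) (v : ℕ → Fin n → ℝ)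
    (k : Fin n) {k' : ℕ} (hk : k' ≤ k) :
    ∃ β : Fin n → ℝ, β ≠ 0 ∧ (∀ i, k < i → β i = 0) ∧ ∀ b < k', U.mulVec β ⬝ᵥ v b = 0 := by
  let T : (Fin n → ℝ) →ₗ[ℝ] (Fin k' → ℝ) × ({i : Fin n // k < i} → ℝ) :=
    LinearMap.prod (LinearMap.pi fun b : Fin k' =>
      { toFun := fun β => U.mulVec β ⬝ᵥ v b
        map_add' := fun β γ => by rw [Matrix.mulVec_add, add_dotProduct]
        map_smul' := fun c β => by rw [Matrix.mulVec_smul, smul_dotProduct]; rfl })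
      (LinearMap.funLeft ℝ ℝ Subtype.val)
  have hcard : Fintype.card {i : Fin n // k < i} = n - 1 - k := by
    rw [Fintype.card_subtype, ← Fin.card_Ioi k]
    congr 1
    ext i
    simp
  -- There are `k' + (n - 1 - k) < n` linear conditions on `n` unknowns.
  have hT : LinearMap.ker T ≠ ⊥ := by
    refine LinearMap.ker_ne_bot_of_finrank_lt ?_
    rw [Module.finrank_prod, Module.finrank_fintype_fun_eq_card, Module.finrank_fintype_fun_eq_card,
      Module.finrank_fintype_fun_eq_card, hcard, Fintype.card_fin, Fintype.card_fin]
    have := k.2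
    omega
  obtain ⟨β, hβ, hβ0⟩ := (Submodule.ne_bot_iff _).1 hT
  rw [LinearMap.mem_ker] at hβ
  refine ⟨β, hβ0, fun i hi => ?_, fun b hb => ?_⟩
  · exact congrFun (congrArg Prod.snd hβ) ⟨i, hi⟩
  · exact congrFun (congrArg Prod.fst hβ) ⟨b, hb⟩

section
variable {n r : ℕ} {a : ℝ} {f : ℝ → ℝ} {x : Fin n → ℝ} {lam : Fin n → ℝ → ℝ}
  {P : Fin n → ℝ → Matrix (Fin n) (Fin n) ℝ}

/-- The upper half of the Courant–Fischer principle: on the span of the first `k + 1` eigenvectors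
the form is at least `λ_k`, and that span contains a vector `u` with `min k r` vanishing moments, on
which the form is `O(ε^L)`. -/
theorem IsAnalyticEVD.exists_eigenvalue_bound (h : IsAnalyticEVD (scaledKernelMatrix f x) lam P)
    (hf : HasSmoothnessOrder a r f) (ha : 0 < a)
    (hpsd : ∀ᶠ ε in 𝓝[>] (0 : ℝ), (scaledKernelMatrix f x ε).PosSemidef) (k : Fin n) :
    ∃ C, ∀ᶠ ε in 𝓝[>] (0 : ℝ), |lam k ε| ≤ C * ε ^ eigenvalueOrder r k := by
  have hr := hf.pos
  set L := eigenvalueOrder r k with hLdef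
  have hLk : L ≤ min (k : ℕ) r + min (k : ℕ) r := by
    rw [hLdef, eigenvalueOrder]; split_ifs <;> omega
  have hLr : L + 1 ≤ 2 * r := by
    rw [hLdef, eigenvalueOrder]; split_ifs <;> omega
  have hbd : ∃ B, ∀ i j, |taylorMatrix f x L i j| < B := by
    obtain ⟨B, hB⟩ := (Set.finite_range fun q : Fin n × Fin n => |taylorMatrix f x L q.1 q.2|).bddAbove
    -- The strict bound on the limits passes to the remainders for small `ε`.
    exact ⟨B + 1, fun i j => lt_add_of_le_of_pos (hB ⟨(i, j), rfl⟩) one_pos⟩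
  obtain ⟨B, hB⟩ := hbd
  have hH : ∀ᶠ ε in 𝓝[>] (0 : ℝ), ∀ i j, |kernelRemainder f x L ε i j| < B :=
    eventually_all.2 fun i => eventually_all.2 fun j =>
      (((hf.tendsto_kernelRemainder ha (by omega) i j).mono_left
        (nhdsWithin_mono _ fun ε (hε : 0 < ε) => hε.ne')).abs).eventually_lt_const (hB i j)
  refine ⟨B * n, ?_⟩
  filter_upwards [hH, h.eventually_exists_eigenvectors.filter_mono nhdsWithin_le_nhds, h.sorted,
    h.eventually_nonneg hpsd, self_mem_nhdsWithin] with ε hHε ⟨U, hU, _, hA⟩ hs hnn hε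
  rw [abs_of_nonneg (hnn k)]
  obtain ⟨β, hβ0, hβk, hβ⟩ := exists_combination_orthogonal U (fun b i => x i ^ b) k
    (min_le_left (k : ℕ) r)
  set u := U.mulVec β with hu
  have hε' : ε ≠ 0 := (show 0 < ε from hε).ne'
  have h1 := hf.dotProduct_scaledKernelMatrix hβ hβ hLk hLr hε'
  have h2 : U.transpose.mulVec u = β := by
    rw [hu, Matrix.mulVec_mulVec, hU, Matrix.one_mulVec]
  have h3 : u ⬝ᵥ u = β ⬝ᵥ β := by
    conv_lhs => rw [hu]
    rw [dotProduct_comm, Matrix.dotProduct_mulVec, ← Matrix.mulVec_transpose, h2]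
  have h4 : lam k ε * (β ⬝ᵥ β) ≤ u ⬝ᵥ (scaledKernelMatrix f x ε).mulVec u := by
    rw [dotProduct_mulVec_eq_sum hA, dotProduct, Finset.mul_sum]
    refine Finset.sum_le_sum fun i _ => ?_
    change _ ≤ lam i ε * (U.transpose.mulVec u i) ^ 2
    rw [h2, ← sq]
    by_cases hi : k < i
    · simp [hβk i hi]
    · exact mul_le_mul_of_nonneg_right (hs (not_lt.1 hi)) (sq_nonneg _)
  have h5 := (abs_le.1 (abs_dotProduct_mulVec_le (fun i j => (hHε i j).le) u)).2
  have h6 : 0 < β ⬝ᵥ β := by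
    refine lt_of_le_of_ne (Finset.sum_nonneg fun i _ => mul_self_nonneg (β i)) (Ne.symm ?_)
    rwa [ne_eq, dotProduct_self_eq_zero]
  have h7 : 0 < ε ^ L := pow_pos hε L
  rw [h1] at h4
  refine le_of_mul_le_mul_right (h4.trans ?_) h6
  rw [← h3]
  calc ε ^ L * (u ⬝ᵥ (kernelRemainder f x L ε).mulVec u) ≤ ε ^ L * (B * n * (u ⬝ᵥ u)) :=
        mul_le_mul_of_nonneg_left h5 h7.le
    _ = _ := by ring

theorem IsAnalyticEVD.exists_mainTerms (h : IsAnalyticEVD (scaledKernelMatrix f x) lam P)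
    (hf : HasSmoothnessOrder a r f) (ha : 0 < a)
    (hpsd : ∀ᶠ ε in 𝓝[>] (0 : ℝ), (scaledKernelMatrix f x ε).PosSemidef) :
    ∃ μ : Fin n → ℝ, ∀ k, HasMainTerm (lam k) (eigenvalueOrder r k) (μ k) := by
  have : ∀ k, ∃ c, HasMainTerm (lam k) (eigenvalueOrder r k) c := fun k => by
    obtain ⟨C, hC⟩ := h.exists_eigenvalue_bound hf ha hpsd k
    exact exists_hasMainTerm (h.analytic_eigenvalue k) hC
  exact ⟨fun k => (this k).choose, fun k => (this k).choose_spec⟩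

end

/-! ### Determinants of graded matrices -/

section
variable {ι₁ ι₂ : Type*} [Fintype ι₁] [Fintype ι₂] [DecidableEq ι₁] [DecidableEq ι₂]
  {B : ℝ → Matrix (ι₁ ⊕ ι₂) (ι₁ ⊕ ι₂) ℝ} {d : ι₁ ⊕ ι₂ → ℝ → ℝ} {a b : ι₁ ⊕ ι₂ → ℕ} {L : ℕ}
  {M : Matrix (ι₁ ⊕ ι₂) (ι₁ ⊕ ι₂) ℝ} {ν : ι₁ ⊕ ι₂ → ℝ}

/-- Limit of the characteristic polynomial of a matrix whose entries have graded orders. -/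
theorem det_mul_det_eq_of_graded
    (hdet : ∀ᶠ ε in 𝓝[>] (0 : ℝ), ∀ z : ℝ,
      (z • (1 : Matrix (ι₁ ⊕ ι₂) (ι₁ ⊕ ι₂) ℝ) - B ε).det = ∏ k, (z - d k ε))
    (hB : ∀ i j, Tendsto (fun ε => B ε i j / ε ^ (a i + b j)) (𝓝[>] 0) (𝓝 (M i j)))
    (hd : ∀ k, Tendsto (fun ε => d k ε / ε ^ (a k + b k)) (𝓝[>] 0) (𝓝 (ν k)))
    (h₁ : ∀ i, a (Sum.inl i) + b (Sum.inl i) < L) (h₂ : ∀ i, a (Sum.inr i) + b (Sum.inr i) = L)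
    (h₁₂ : ∀ i j, M (Sum.inl i) (Sum.inr j) = 0) (z : ℝ) :
    (-M.toBlocks₁₁).det * (z • (1 : Matrix ι₂ ι₂ ℝ) - M.toBlocks₂₂).det =
      (∏ i, -ν (Sum.inl i)) * ∏ i, (z - ν (Sum.inr i)) := by
  -- The rescaled spectral parameter `z ε^L` disappears on the block of order below `L` and survives
  -- on the block of order exactly `L`.
  let ζ : ι₁ ⊕ ι₂ → ℝ := Sum.elim (fun _ => 0) fun _ => z
  have hpos : ∀ᶠ ε in 𝓝[>] (0 : ℝ), 0 < ε := self_mem_nhdsWithin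
  have hζ : ∀ k, Tendsto (fun ε => z * ε ^ L / ε ^ (a k + b k)) (𝓝[>] 0) (𝓝 (ζ k)) := by
    rintro (k | k)
    · have h3 : Continuous fun ε : ℝ => z * ε ^ (L - (a (Sum.inl k) + b (Sum.inl k))) := by fun_prop
      have h4 := (h3.tendsto 0).mono_left (nhdsWithin_le_nhds (s := Set.Ioi 0))
      rw [zero_pow (Nat.sub_ne_zero_of_lt (h₁ k)), mul_zero] at h4
      refine h4.congr' ?_
      filter_upwards [hpos] with ε hε
      rw [mul_div_assoc, pow_sub₀ _ hε.ne' (h₁ k).le, div_eq_mul_inv]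
    · rw [h₂ k]
      refine tendsto_const_nhds.congr' ?_
      filter_upwards [hpos] with ε hε
      rw [mul_div_cancel_right₀ _ (pow_ne_zero _ hε.ne')]
      rfl
  let X : ℝ → Matrix (ι₁ ⊕ ι₂) (ι₁ ⊕ ι₂) ℝ := fun ε =>
    (z * ε ^ L) • (1 : Matrix (ι₁ ⊕ ι₂) (ι₁ ⊕ ι₂) ℝ) - B ε
  have hX : Tendsto (fun ε => (Matrix.of fun i j => X ε i j / ε ^ (a i + b j)).det) (𝓝[>] 0)
      (𝓝 (Matrix.diagonal ζ - M).det) := by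
    refine ((Continuous.matrix_det continuous_id).tendsto _).comp ?_
    refine tendsto_pi_nhds.2 fun i => tendsto_pi_nhds.2 fun j => ?_
    by_cases hij : i = j
    · subst hij
      have := (hζ i).sub (hB i i)
      simpa [X, sub_div] using this
    · have := (hB i j).neg
      simpa [X, sub_div, hij, neg_div] using this
  have hY : Tendsto (fun ε => ∏ k, ((z * ε ^ L - d k ε) / ε ^ (a k + b k))) (𝓝[>] 0)
      (𝓝 (∏ k, (ζ k - ν k))) := by
    refine tendsto_finsetProd _ fun k _ => ?_
    simp only [sub_div]
    exact (hζ k).sub (hd k)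
  have hXY : (Matrix.diagonal ζ - M).det = ∏ k, (ζ k - ν k) := by
    refine tendsto_nhds_unique hX (hY.congr' ?_)
    filter_upwards [hdet, hpos] with ε h hε
    -- Row and column scalings give the determinant the same factor `∏ ε^(a k + b k)` by which the
    -- eigenvalue product is divided.
    have e1 : (Matrix.of fun i j => X ε i j / ε ^ (a i + b j)) =
        Matrix.of fun i j => (ε ^ a i)⁻¹ * (Matrix.of fun i j => (ε ^ b j)⁻¹ * X ε i j) i j := by
      ext i j
      simp only [Matrix.of_apply, pow_add]
      field_simp
    rw [e1, Matrix.det_mul_column, Matrix.det_mul_row, h, ← Finset.prod_mul_distrib,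
      ← Finset.prod_mul_distrib]
    refine Finset.prod_congr rfl fun k _ => ?_
    rw [pow_add]
    field_simp
  have hblock : Matrix.diagonal ζ - M = Matrix.fromBlocks (-M.toBlocks₁₁) 0 (-M.toBlocks₂₁)
      (z • (1 : Matrix ι₂ ι₂ ℝ) - M.toBlocks₂₂) := by
    ext (i | i) (j | j)
    · by_cases hij : i = j
      · subst hij; simp [ζ, Matrix.toBlocks₁₁]
      · simp [hij, Matrix.toBlocks₁₁]
    · simp [h₁₂]
    · simp [Matrix.toBlocks₂₁]
    · by_cases hij : i = j
      · subst hij; simp [ζ, Matrix.toBlocks₂₂]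
      · simp [hij, Matrix.toBlocks₂₂]
  rw [hblock, Matrix.det_fromBlocks_zero₁₂, Fintype.prod_sum_type] at hXY
  simpa [ζ] using hXY

/-- Both sides are polynomials in `z`, each a constant times a monic polynomial: leading
coefficients give the first claim, and cancelling a nonzero one gives the second. -/
theorem det_eq_prod_of_forall_det_mul_det_eq {M₁ : Matrix ι₁ ι₁ ℝ} {M₂ : Matrix ι₂ ι₂ ℝ}
    {ν₁ : ι₁ → ℝ} {ν₂ : ι₂ → ℝ}
    (h : ∀ z : ℝ, (-M₁).det * (z • (1 : Matrix ι₂ ι₂ ℝ) - M₂).det =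
      (∏ i, -ν₁ i) * ∏ i, (z - ν₂ i)) :
    M₁.det = ∏ i, ν₁ i ∧
      (M₁.det ≠ 0 → M₂.charpoly = ∏ i, (Polynomial.X - Polynomial.C (ν₂ i))) := by
  have hpoly : Polynomial.C (-M₁).det * M₂.charpoly =
      Polynomial.C (∏ i, -ν₁ i) * ∏ i, (Polynomial.X - Polynomial.C (ν₂ i)) := by
    refine Polynomial.funext fun z => ?_
    rw [Polynomial.eval_mul, Polynomial.eval_mul, Polynomial.eval_C, Polynomial.eval_C,
      Polynomial.eval_prod, Matrix.eval_charpoly, Matrix.scalar_apply,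
      ← Matrix.smul_one_eq_diagonal, h z]
    simp
  have hmonic : (∏ i, (Polynomial.X - Polynomial.C (ν₂ i))).Monic :=
    Polynomial.monic_prod_X_sub_C _ _
  have hlead := congrArg Polynomial.leadingCoeff hpoly
  rw [Polynomial.leadingCoeff_mul_monic (Matrix.charpoly_monic _),
    Polynomial.leadingCoeff_mul_monic hmonic, Polynomial.leadingCoeff_C,
    Polynomial.leadingCoeff_C] at hlead
  have hsign : ((-1 : ℝ) ^ Fintype.card ι₁) ≠ 0 := pow_ne_zero _ (by norm_num)
  have h1 : M₁.det = ∏ i, ν₁ i := by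
    rw [Matrix.det_neg, Finset.prod_neg, Finset.card_univ] at hlead
    exact mul_left_cancel₀ hsign hlead
  refine ⟨h1, fun h0 => ?_⟩
  have h2 : (-M₁).det ≠ 0 := by
    rw [Matrix.det_neg]
    exact mul_ne_zero hsign h0
  rw [← hlead] at hpoly
  exact mul_left_cancel₀ (Polynomial.C_ne_zero.2 h2) hpoly
end

/-! ### Orthonormal bases adapted to the monomials -/

/-- An orthonormal basis `w` of `ℝ ^ n`, split into `s` and `n - s` vectors, such that the
`i`-th vector is orthogonal to the first `min i s` monomials at the points `x`. -/
structure IsAdaptedBasis {n s : ℕ} (x : Fin n → ℝ) (w : Fin s ⊕ Fin (n - s) → Fin n → ℝ) :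
    Prop where
  orthonormal : ∀ i j, w i ⬝ᵥ w j = (1 : Matrix (Fin s ⊕ Fin (n - s)) (Fin s ⊕ Fin (n - s)) ℝ) i j
  left : ∀ i : Fin s, ∀ b < (i : ℕ), (w (Sum.inl i) ⬝ᵥ fun k => x k ^ b) = 0
  right : ∀ i : Fin (n - s), ∀ b < s, (w (Sum.inr i) ⬝ᵥ fun k => x k ^ b) = 0

/-- The bijection that puts the `Fin s` summand first. -/
def splitEquiv {n s : ℕ} (hs : s ≤ n) : Fin s ⊕ Fin (n - s) ≃ Fin n :=
  finSumFinEquiv.trans (finCongr (Nat.add_sub_cancel' hs))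

theorem splitEquiv_inl {n s : ℕ} (hs : s ≤ n) (i : Fin s) :
    ((splitEquiv hs (Sum.inl i) : Fin n) : ℕ) = i := by
  simp [splitEquiv]

theorem splitEquiv_inr {n s : ℕ} (hs : s ≤ n) (i : Fin (n - s)) :
    ((splitEquiv hs (Sum.inr i) : Fin n) : ℕ) = s + i := by
  simp [splitEquiv]

theorem prod_filter_lt {M : Type*} [CommMonoid M] {n s : ℕ} (hs : s ≤ n) (g : Fin n → M) :
    ∏ k ∈ Finset.univ.filter (fun k : Fin n => (k : ℕ) < s), g k =
      ∏ i : Fin s, g (splitEquiv hs (Sum.inl i)) := by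
  rw [Finset.prod_filter, ← (splitEquiv hs).prod_comp, Fintype.prod_sum_type]
  simp [splitEquiv_inl, splitEquiv_inr]

theorem prod_filter_ge {M : Type*} [CommMonoid M] {n s : ℕ} (hs : s ≤ n) (g : Fin n → M) :
    ∏ k ∈ Finset.univ.filter (fun k : Fin n => s ≤ (k : ℕ)), g k =
      ∏ i : Fin (n - s), g (splitEquiv hs (Sum.inr i)) := by
  rw [Finset.prod_filter, ← (splitEquiv hs).prod_comp, Fintype.prod_sum_type]
  simp [splitEquiv_inl, splitEquiv_inr, Nat.not_le.2]

theorem exists_orthonormal_orthogonal {n : ℕ} (v : Fin n → Fin n → ℝ) :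
    ∃ q : Fin n → Fin n → ℝ, (∀ i j, q i ⬝ᵥ q j = (1 : Matrix (Fin n) (Fin n) ℝ) i j) ∧
      ∀ i j, j < i → q i ⬝ᵥ v j = 0 := by
  have hc : Module.finrank ℝ (EuclideanSpace ℝ (Fin n)) = Fintype.card (Fin n) := by simp
  let b := InnerProductSpace.gramSchmidtOrthonormalBasis hc fun j => WithLp.toLp 2 (v j)
  have hinner : ∀ y z : EuclideanSpace ℝ (Fin n), inner ℝ y z = y.ofLp ⬝ᵥ z.ofLp := fun y z => by
    rw [EuclideanSpace.inner_eq_star_dotProduct, star_trivial, dotProduct_comm]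
  refine ⟨fun i => (b i).ofLp, fun i j => ?_, fun i j hij => ?_⟩
  · rw [← hinner, orthonormal_iff_ite.1 b.orthonormal, Matrix.one_apply]
  · have := InnerProductSpace.gramSchmidtOrthonormalBasis_inv_triangular hc
      (fun j => WithLp.toLp 2 (v j)) hij
    rw [hinner] at this
    exact this

/-- Gram–Schmidt applied to the monomials, completed to a basis if the points are not distinct. -/
theorem exists_isAdaptedBasis {n s : ℕ} (hs : s ≤ n) (x : Fin n → ℝ) :
    ∃ w : Fin s ⊕ Fin (n - s) → Fin n → ℝ, IsAdaptedBasis x w := by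
  obtain ⟨q, hq, hqx⟩ := exists_orthonormal_orthogonal fun j i : Fin n => x i ^ (j : ℕ)
  refine ⟨fun i => q (splitEquiv hs i), fun i j => ?_, fun i b hb => ?_, fun i b hb => ?_⟩
  · rw [hq]
    simp [Matrix.one_apply]
  · exact hqx _ ⟨b, by omega⟩ (by rw [Fin.lt_def, splitEquiv_inl]; exact hb)
  · exact hqx _ ⟨b, by omega⟩ (by rw [Fin.lt_def, splitEquiv_inr]; exact Nat.lt_add_right _ hb)

section
variable {n s : ℕ} {x : Fin n → ℝ} {w : Fin s ⊕ Fin (n - s) → Fin n → ℝ}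

/-- The square matrix with columns `w`. -/
def basisMatrix {n s : ℕ} (hs : s ≤ n) (w : Fin s ⊕ Fin (n - s) → Fin n → ℝ) :
    Matrix (Fin n) (Fin n) ℝ :=
  Matrix.of fun i k => w ((splitEquiv hs).symm k) i

theorem IsAdaptedBasis.transpose_mul (h : IsAdaptedBasis x w) (hs : s ≤ n) :
    (basisMatrix hs w).transpose * basisMatrix hs w = 1 := by
  ext i j
  change w _ ⬝ᵥ w _ = _
  rw [h.orthonormal]
  simp [Matrix.one_apply]

/-- Parseval's identity. -/
theorem IsAdaptedBasis.dotProduct_eq (h : IsAdaptedBasis x w) (hs : s ≤ n) (y z : Fin n → ℝ) :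
    y ⬝ᵥ z = ∑ k, (w k ⬝ᵥ y) * (w k ⬝ᵥ z) := by
  have h1 : basisMatrix hs w * (basisMatrix hs w).transpose = 1 :=
    mul_eq_one_comm.1 (h.transpose_mul hs)
  have h2 : y ⬝ᵥ z = (basisMatrix hs w).transpose.mulVec y ⬝ᵥ (basisMatrix hs w).transpose.mulVec z := by
    rw [Matrix.dotProduct_mulVec, ← Matrix.mulVec_transpose, Matrix.transpose_transpose,
      Matrix.mulVec_mulVec, h1, Matrix.one_mulVec]
  rw [h2, ← (splitEquiv hs).symm.sum_comp]
  rfl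

theorem IsAdaptedBasis.det_eq (h : IsAdaptedBasis x w) (hs : s ≤ n)
    (A : Matrix (Fin n) (Fin n) ℝ) (z : ℝ) :
    (z • (1 : Matrix (Fin s ⊕ Fin (n - s)) (Fin s ⊕ Fin (n - s)) ℝ) -
      Matrix.of fun i j => w i ⬝ᵥ A.mulVec (w j)).det =
      (z • (1 : Matrix (Fin n) (Fin n) ℝ) - A).det := by
  set Q := basisMatrix hs w
  have h0 : Q.transpose * Q = 1 := h.transpose_mul hs
  have h1 : (z • (1 : Matrix (Fin s ⊕ Fin (n - s)) (Fin s ⊕ Fin (n - s)) ℝ) -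
      Matrix.of fun i j => w i ⬝ᵥ A.mulVec (w j)) =
      (Q.transpose * (z • (1 : Matrix (Fin n) (Fin n) ℝ) - A) * Q).submatrix
        (splitEquiv hs) (splitEquiv hs) := by
    rw [mul_sub, sub_mul, Matrix.mul_smul, Matrix.smul_mul, mul_one, h0, mul_assoc]
    ext i j
    have h2 : (Q.transpose * (A * Q)) (splitEquiv hs i) (splitEquiv hs j) =
        w i ⬝ᵥ A.mulVec (w j) := by
      simp [Q, basisMatrix, Matrix.mul_apply, dotProduct, Matrix.mulVec]
    simp [h2, Matrix.one_apply]
  rw [h1, Matrix.det_submatrix_equiv_self, Matrix.det_mul, Matrix.det_mul, mul_right_comm,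
    ← Matrix.det_mul, h0, Matrix.det_one, one_mul]

/-- The triangular factor of the Vandermonde matrix. -/
theorem IsAdaptedBasis.vandermonde_eq (h : IsAdaptedBasis x w) (hs : s ≤ n) :
    (vandermonde x s).transpose * vandermonde x s =
      (Matrix.of fun i j : Fin s => w (Sum.inl i) ⬝ᵥ fun k => x k ^ (j : ℕ)).transpose *
        Matrix.of fun i j : Fin s => w (Sum.inl i) ⬝ᵥ fun k => x k ^ (j : ℕ) := by
  ext i j
  change (fun k => x k ^ (i : ℕ)) ⬝ᵥ (fun k => x k ^ (j : ℕ)) = _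
  rw [h.dotProduct_eq hs, Fintype.sum_sum_type, Matrix.mul_apply]
  simp [h.right _ _ i.2]

theorem IsAdaptedBasis.det_triangular (h : IsAdaptedBasis x w) :
    (Matrix.of fun i j : Fin s => w (Sum.inl i) ⬝ᵥ fun k => x k ^ (j : ℕ)).det =
      ∏ i : Fin s, w (Sum.inl i) ⬝ᵥ fun k => x k ^ (i : ℕ) :=
  Matrix.det_of_isUpperTriangular fun i j hij => h.left i j hij

theorem IsAdaptedBasis.det_vandermonde (h : IsAdaptedBasis x w) (hs : s ≤ n) :
    ((vandermonde x s).transpose * vandermonde x s).det =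
      (∏ i : Fin s, w (Sum.inl i) ⬝ᵥ fun k => x k ^ (i : ℕ)) ^ 2 := by
  rw [h.vandermonde_eq hs, Matrix.det_mul, Matrix.det_transpose, h.det_triangular, sq]

/-- The last vectors of an adapted basis can be replaced by any orthonormal vectors that are
orthogonal to the first `s` monomials. -/
theorem IsAdaptedBasis.replace_right (h : IsAdaptedBasis x w) (hs : s ≤ n)
    (hV : ((vandermonde x s).transpose * vandermonde x s).det ≠ 0)
    {Qp : Matrix (Fin n) (Fin (n - s)) ℝ} (hQ : Qp.transpose * Qp = 1)
    (hQV : Qp.transpose * vandermonde x s = 0) :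
    IsAdaptedBasis x (Sum.elim (fun i => w (Sum.inl i)) fun j i => Qp i j) := by
  have hmom : ∀ j : Fin (n - s), ∀ b < s, ((fun i => Qp i j) ⬝ᵥ fun k => x k ^ b) = 0 :=
    fun j b hb => congrFun (congrFun hQV j) ⟨b, hb⟩
  have horth : ∀ (j : Fin (n - s)) (i : Fin s), w (Sum.inl i) ⬝ᵥ (fun i => Qp i j) = 0 := by
    -- A vector with vanishing moments has coordinates on the first `s` basis vectors that are
    -- annihilated by the triangular factor, which is invertible by `hV`.
    intro j
    have hR : (Matrix.of fun i j : Fin s => w (Sum.inl i) ⬝ᵥ fun k => x k ^ (j : ℕ)).det ≠ 0 := by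
      intro h0
      rw [h.det_triangular] at h0
      rw [h.det_vandermonde hs, h0] at hV
      simp at hV
    have h1 : Matrix.vecMul (fun i => w (Sum.inl i) ⬝ᵥ fun i => Qp i j)
        (Matrix.of fun i j : Fin s => w (Sum.inl i) ⬝ᵥ fun k => x k ^ (j : ℕ)) = 0 := by
      funext b
      have h2 := hmom j b b.2
      rw [h.dotProduct_eq hs, Fintype.sum_sum_type] at h2
      simp only [h.right _ _ b.2, mul_zero, Finset.sum_const_zero, add_zero] at h2
      exact h2
    exact fun i => congrFun (Matrix.eq_zero_of_vecMul_eq_zero hR h1) i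
  refine ⟨?_, fun i b hb => h.left i b hb, hmom⟩
  rintro (i | i) (j | j)
  · simpa [Matrix.one_apply] using h.orthonormal (Sum.inl i) (Sum.inl j)
  · simpa [Matrix.one_apply] using horth j i
  · have := horth i j
    rw [dotProduct_comm] at this
    simpa [Matrix.one_apply] using this
  · have : (fun k => Qp k i) ⬝ᵥ (fun k => Qp k j) = (1 : Matrix _ _ ℝ) i j := by rw [← hQ]; rfl
    simpa [Matrix.one_apply] using this
end

theorem det_transpose_mul_vandermonde_ne_zero {n s : ℕ} (hs : s ≤ n) {x : Fin n → ℝ}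
    (hx : Function.Injective x) : ((vandermonde x s).transpose * vandermonde x s).det ≠ 0 := by
  intro h0
  obtain ⟨v, hv0, hv⟩ := Matrix.exists_mulVec_eq_zero_iff.2 h0
  have h1 : (vandermonde x s).mulVec v = 0 := by
    rw [← dotProduct_self_eq_zero, Matrix.dotProduct_mulVec, ← Matrix.mulVec_transpose,
      Matrix.mulVec_mulVec, hv, zero_dotProduct]
  have h2 : v = 0 := by
    refine Matrix.eq_zero_of_forall_index_sum_pow_mul_eq_zero (f := fun i => x (Fin.castLE hs i))
      (hx.comp (Fin.castLE_injective hs)) fun j => ?_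
    exact congrFun h1 (Fin.castLE hs j)
  exact hv0 h2

theorem HasMainTerm.tendsto_of_lt {g : ℝ → ℝ} {L L' : ℕ} {c : ℝ} (h : HasMainTerm g L c)
    (hL : L' < L) : Tendsto (fun ε => g ε / ε ^ L') (𝓝[≠] 0) (𝓝 0) := by
  have h1 : Tendsto (fun ε : ℝ => ε ^ (L - L')) (𝓝[≠] 0) (𝓝 0) := by
    have := ((continuous_pow (M := ℝ) (L - L')).tendsto 0).mono_left
      (nhdsWithin_le_nhds (s := {0}ᶜ))
    rwa [zero_pow (Nat.sub_ne_zero_of_lt hL)] at this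
  have h2 := h.tendsto.mul h1
  rw [mul_zero] at h2
  refine h2.congr' ?_
  filter_upwards [self_mem_nhdsWithin] with ε hε
  have hε' : ε ≠ 0 := hε
  rw [pow_sub₀ _ hε' hL.le]
  field_simp

theorem nhdsGT_le_nhdsNE_zero : 𝓝[>] (0 : ℝ) ≤ 𝓝[≠] 0 :=
  nhdsWithin_mono _ fun _ (hε : _ < _) => hε.ne'

/-! ### Main terms of the eigenvalues -/

section
variable {n r : ℕ} {a : ℝ} {f : ℝ → ℝ} {x : Fin n → ℝ} {lam : Fin n → ℝ → ℝ}
  {P : Fin n → ℝ → Matrix (Fin n) (Fin n) ℝ} {μ : Fin n → ℝ}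

/-- The upper left block of the graded limit is `Δ W Δ`, where `Δ` is the diagonal of the triangular
factor and `(det Δ)^2 = det (Vᵀ V)`. For `s = r` the lower right block carries the remaining main
terms. -/
theorem IsAnalyticEVD.prod_mainTerms_and_charpoly
    (h : IsAnalyticEVD (scaledKernelMatrix f x) lam P)
    (hf : HasSmoothnessOrder a r f) (ha : 0 < a)
    (hμ : ∀ k, HasMainTerm (lam k) (eigenvalueOrder r k) (μ k)) {s : ℕ} (hs : 1 ≤ s) (hsr : s ≤ r)
    (hsn : s ≤ n) {w : Fin s ⊕ Fin (n - s) → Fin n → ℝ} (hw : IsAdaptedBasis x w) :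
    ∏ i : Fin s, μ (splitEquiv hsn (Sum.inl i)) =
        ((vandermonde x s).transpose * vandermonde x s).det *
          (wronskian (radialKernel f) s).det ∧
      (s = r → ((vandermonde x s).transpose * vandermonde x s).det *
          (wronskian (radialKernel f) s).det ≠ 0 →
        (Matrix.of fun i j : Fin (n - s) =>
          w (Sum.inr i) ⬝ᵥ (taylorMatrix f x (2 * s - 1)).mulVec (w (Sum.inr j))).charpoly =
        ∏ i : Fin (n - s), (Polynomial.X - Polynomial.C (μ (splitEquiv hsn (Sum.inr i))))) := by
  let e := splitEquiv hsn
  -- On the second block the row and column exponents differ, `s` and `s - 1`, so that their sum is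
  -- the odd order `2s - 1` with natural exponents.
  let A : Fin s ⊕ Fin (n - s) → ℕ := Sum.elim (fun i => i) fun _ => s
  let B : Fin s ⊕ Fin (n - s) → ℕ := Sum.elim (fun i => i) fun _ => s - 1
  let M : Matrix (Fin s ⊕ Fin (n - s)) (Fin s ⊕ Fin (n - s)) ℝ :=
    Matrix.of fun i j => w i ⬝ᵥ (taylorMatrix f x (A i + B j)).mulVec (w j)
  let ν : Fin s ⊕ Fin (n - s) → ℝ :=
    Sum.elim (fun i => μ (e (Sum.inl i))) fun j => if s = r then μ (e (Sum.inr j)) else 0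
  have hA : ∀ i, A i ≤ s := by rintro (i | i); exacts [i.2.le, le_rfl]
  have hB : ∀ i, B i ≤ s - 1 := by rintro (i | i); exacts [by have := i.2; simp [B]; omega, le_rfl]
  have hmomA : ∀ i, ∀ b < A i, (w i ⬝ᵥ fun k => x k ^ b) = 0 := by
    rintro (i | i) b hb
    exacts [hw.left i b hb, hw.right i b hb]
  have hmomB : ∀ i, ∀ b < B i, (w i ⬝ᵥ fun k => x k ^ b) = 0 := by
    rintro (i | i) b hb
    exacts [hw.left i b hb, hw.right i b (lt_of_lt_of_le hb (Nat.sub_le _ _))]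
  have key := det_mul_det_eq_of_graded
    (B := fun ε => Matrix.of fun i j => w i ⬝ᵥ (scaledKernelMatrix f x ε).mulVec (w j))
    (d := fun k => lam (e k)) (a := A) (b := B) (L := 2 * s - 1) (M := M) (ν := ν)
    (by
      filter_upwards [h.eventually_det.filter_mono nhdsWithin_le_nhds] with ε hε z
      rw [hw.det_eq hsn, hε, e.prod_comp fun k => z - lam k ε])
    (fun i j => (hf.tendsto_dotProduct_scaledKernelMatrix ha (hmomA i) (hmomB j) le_rfl
      (by have := hA i; have := hB j; omega)).mono_left nhdsGT_le_nhdsNE_zero)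
    (by
      refine fun k => Tendsto.mono_left ?_ nhdsGT_le_nhdsNE_zero
      rcases k with i | j
      · have h1 := (hμ (e (Sum.inl i))).tendsto
        rw [eigenvalueOrder, splitEquiv_inl, if_pos (lt_of_lt_of_le i.2 hsr), two_mul] at h1
        exact h1
      · have hAB : A (Sum.inr j) + B (Sum.inr j) = 2 * s - 1 := by
          change s + (s - 1) = _
          omega
        rw [hAB]
        by_cases hsr' : s = r
        · have h1 := (hμ (e (Sum.inr j))).tendsto
          rw [eigenvalueOrder, splitEquiv_inr, if_neg (by omega), ← hsr'] at h1
          simpa [ν, hsr'] using h1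
        -- For `s < r` the remaining eigenvalues have order at least `2s`, or `2r - 1`, both above
        -- `2s - 1`; they contribute zero.
        · have h1 := (hμ (e (Sum.inr j))).tendsto_of_lt (L' := 2 * s - 1) (by
            rw [eigenvalueOrder, splitEquiv_inr]
            split_ifs <;> omega)
          simpa [ν, hsr'] using h1)
    (fun i => by have := i.2; simp only [A, B, Sum.elim_inl]; omega)
    (fun i => by simp only [A, B, Sum.elim_inr]; omega)
    -- The upper right block has degree `i + (s - 1)`, whereas the vanishing moments cancel all
    -- degrees below `i + s`.
    (fun i j => hf.dotProduct_taylorMatrix_eq_zero (hmomA (Sum.inl i)) (hw.right j)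
      (by have := i.2; simp only [A, B, Sum.elim_inr, Sum.elim_inl]; omega)
      (by have := i.2; simp only [A, B, Sum.elim_inr, Sum.elim_inl]; omega))
  obtain ⟨h1, h2⟩ := det_eq_prod_of_forall_det_mul_det_eq key
  have hM : M.toBlocks₁₁.det = ((vandermonde x s).transpose * vandermonde x s).det *
      (wronskian (radialKernel f) s).det := by
    have h3 : M.toBlocks₁₁ = Matrix.of fun i j : Fin s => (w (Sum.inl i) ⬝ᵥ fun k => x k ^ (i : ℕ)) *
        (Matrix.of fun i j : Fin s => (w (Sum.inl j) ⬝ᵥ fun k => x k ^ (j : ℕ)) *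
          wronskian (radialKernel f) s i j) i j := by
      ext i j
      have hij : (i : ℕ) + j + 2 ≤ 2 * r := by have := i.2; have := j.2; omega
      change w (Sum.inl i) ⬝ᵥ (taylorMatrix f x (i + j)).mulVec (w (Sum.inl j)) = _
      rw [hf.dotProduct_taylorMatrix_add (hw.left i) (hw.left j) hij, Matrix.of_apply,
        Matrix.of_apply, hf.wronskian_apply ha i j hij]
      ring
    rw [h3, Matrix.det_mul_column, Matrix.det_mul_row, hw.det_vandermonde hsn]
    ring
  rw [hM] at h1 h2
  refine ⟨h1.symm, fun hsr' h0 => ?_⟩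
  have h4 := h2 h0
  simp only [ν, Sum.elim_inr, if_pos hsr'] at h4
  rw [← h4]
  congr 1
  ext i j
  change _ = w (Sum.inr i) ⬝ᵥ (taylorMatrix f x (s + (s - 1))).mulVec (w (Sum.inr j))
  rw [show s + (s - 1) = 2 * s - 1 by omega]
  rfl

theorem IsAnalyticEVD.prod_mainTerms
    (h : IsAnalyticEVD (scaledKernelMatrix f x) lam P)
    (hf : HasSmoothnessOrder a r f) (ha : 0 < a)
    (hμ : ∀ k, HasMainTerm (lam k) (eigenvalueOrder r k) (μ k)) (hrn : r ≤ n) {s : ℕ}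
    (hs : 1 ≤ s) (hsr : s ≤ r) :
    ∏ k ∈ Finset.univ.filter (fun k : Fin n => (k : ℕ) < s), μ k =
      ((vandermonde x s).transpose * vandermonde x s).det *
        (wronskian (radialKernel f) s).det := by
  obtain ⟨w, hw⟩ := exists_isAdaptedBasis (hsr.trans hrn) x
  rw [prod_filter_lt (hsr.trans hrn)]
  exact (h.prod_mainTerms_and_charpoly hf ha hμ hs hsr _ hw).1

theorem IsAnalyticEVD.mainTerm_eq_div
    (h : IsAnalyticEVD (scaledKernelMatrix f x) lam P)
    (hf : HasSmoothnessOrder a r f) (ha : 0 < a)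
    (hμ : ∀ k, HasMainTerm (lam k) (eigenvalueOrder r k) (μ k)) (hrn : r ≤ n) (k : Fin n)
    (hk : 0 < (k : ℕ)) (hkr : (k : ℕ) < r)
    (hV : ((vandermonde x k).transpose * vandermonde x k).det ≠ 0)
    (hW : (wronskian (radialKernel f) k).det ≠ 0) :
    μ k = ((vandermonde x (k + 1)).transpose * vandermonde x (k + 1)).det /
        ((vandermonde x k).transpose * vandermonde x k).det *
      ((wronskian (radialKernel f) (k + 1)).det / (wronskian (radialKernel f) k).det) := by
  have h1 := h.prod_mainTerms hf ha hμ hrn hk hkr.le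
  have h2 := h.prod_mainTerms hf ha hμ hrn (Nat.le_add_left 1 k) hkr
  have h3 : Finset.univ.filter (fun j : Fin n => (j : ℕ) < k + 1) =
      insert k (Finset.univ.filter fun j : Fin n => (j : ℕ) < k) := by
    ext j
    simp only [Finset.mem_filter, Finset.mem_univ, true_and, Finset.mem_insert, Fin.ext_iff]
    omega
  rw [h3, Finset.prod_insert (by simp), h1] at h2
  field_simp
  linarith

theorem IsAnalyticEVD.mainTerm_nonneg
    (h : IsAnalyticEVD (scaledKernelMatrix f x) lam P)
    (hpsd : ∀ᶠ ε in 𝓝[>] (0 : ℝ), (scaledKernelMatrix f x ε).PosSemidef)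
    (hμ : ∀ k, HasMainTerm (lam k) (eigenvalueOrder r k) (μ k)) (k : Fin n) : 0 ≤ μ k := by
  refine ge_of_tendsto ((hμ k).tendsto.mono_left nhdsGT_le_nhdsNE_zero) ?_
  filter_upwards [h.eventually_nonneg hpsd, self_mem_nhdsWithin] with ε h1 h2
  exact div_nonneg (h1 k) (pow_nonneg (le_of_lt h2) _)

/-- Vectors orthogonal to the first `k + 1` monomials are orthogonal to the limiting eigenvector
with index `k` if the main term does not vanish. -/
theorem IsAnalyticEVD.dotProduct_limiting_eq_zero
    (h : IsAnalyticEVD (scaledKernelMatrix f x) lam P)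
    (hf : HasSmoothnessOrder a r f) (ha : 0 < a)
    (hpsd : ∀ᶠ ε in 𝓝[>] (0 : ℝ), (scaledKernelMatrix f x ε).PosSemidef)
    (hμ : ∀ k, HasMainTerm (lam k) (eigenvalueOrder r k) (μ k)) {p : Fin n → Fin n → ℝ}
    (hp : IsLimitingEigenvectors P p) {k : Fin n} (hkr : (k : ℕ) < r) (hk0 : μ k ≠ 0)
    {q : Fin n → ℝ} (hq : ∀ b ≤ (k : ℕ), (q ⬝ᵥ fun i => x i ^ b) = 0) : q ⬝ᵥ p k = 0 := by
  have hq' : ∀ b < (k : ℕ), (q ⬝ᵥ fun i => x i ^ b) = 0 := fun b hb => hq b hb.le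
  have h1 := (hf.tendsto_dotProduct_scaledKernelMatrix ha hq' hq' (L := 2 * k) (by omega)
    (by omega)).mono_left nhdsGT_le_nhdsNE_zero
  -- The extra vanishing moment of degree `k` cancels the coefficient of `ε^(2k)` as well.
  rw [hf.dotProduct_taylorMatrix_eq_zero (i := k + 1) (fun b hb => hq b (by omega)) hq'
    (by omega) (by omega)] at h1
  have h2 := (hμ k).tendsto.mono_left nhdsGT_le_nhdsNE_zero
  rw [eigenvalueOrder, if_pos hkr] at h2
  have h3 : Tendsto (fun ε => q ⬝ᵥ (P k ε).mulVec q) (𝓝[>] 0) (𝓝 (q ⬝ᵥ (P k 0).mulVec q)) := by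
    simp only [dotProduct, Matrix.mulVec]
    exact tendsto_finsetSum _ fun i _ => (tendsto_finsetSum _ fun j _ =>
      (((h.analytic_projector k i j).continuousAt.tendsto).mono_left
        nhdsWithin_le_nhds).mul_const _).const_mul _
  have h4 : μ k * (q ⬝ᵥ (P k 0).mulVec q) ≤ 0 := by
    refine le_of_tendsto_of_tendsto (h2.mul h3) h1 ?_
    filter_upwards [h.eventually_mul_le hpsd, self_mem_nhdsWithin] with ε h5 h6
    have h7 : 0 < ε ^ (2 * (k : ℕ)) := pow_pos h6 _
    rw [div_mul_eq_mul_div]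
    exact div_le_div_of_nonneg_right (h5 k q) h7.le
  have h5 : q ⬝ᵥ (P k 0).mulVec q = (q ⬝ᵥ p k) ^ 2 := by
    rw [hp k, Matrix.vecMulVec_mulVec]
    simp [dotProduct_comm (p k) q, sq]
  rw [h5] at h4
  have h6 : 0 < μ k := lt_of_le_of_ne (h.mainTerm_nonneg hpsd hμ k) hk0.symm
  exact (pow_eq_zero_iff two_ne_zero).1 (le_antisymm
    (not_lt.1 fun h7 => absurd h4 (not_le.2 (mul_pos h6 h7))) (sq_nonneg _))
end

/-! ### Limiting eigenvectors and the projected distance matrix -/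

section
variable {n r : ℕ} {a : ℝ} {f : ℝ → ℝ} {x : Fin n → ℝ} {lam : Fin n → ℝ → ℝ}
  {P : Fin n → ℝ → Matrix (Fin n) (Fin n) ℝ} {μ : Fin n → ℝ}

theorem IsAnalyticEVD.mainTerm_ne_zero
    (h : IsAnalyticEVD (scaledKernelMatrix f x) lam P)
    (hf : HasSmoothnessOrder a r f) (ha : 0 < a)
    (hμ : ∀ k, HasMainTerm (lam k) (eigenvalueOrder r k) (μ k)) (hrn : r ≤ n)
    (hx : Function.Injective x) {s : ℕ} (hs : 1 ≤ s) (hsr : s ≤ r)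
    (hW : (wronskian (radialKernel f) s).det ≠ 0) {k : Fin n} (hk : (k : ℕ) < s) : μ k ≠ 0 := by
  have h1 : ∏ k ∈ Finset.univ.filter (fun k : Fin n => (k : ℕ) < s), μ k ≠ 0 := by
    rw [h.prod_mainTerms hf ha hμ hrn hs hsr]
    exact mul_ne_zero (det_transpose_mul_vandermonde_ne_zero (hsr.trans hrn) hx) hW
  exact Finset.prod_ne_zero_iff.1 h1 k (by simpa using hk)

/-- `p k` is orthogonal to the later columns of `Q`, which have vanishing moments up to degree `k`,
and to the earlier ones, which by induction are earlier limiting eigenvectors up to sign. -/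
theorem IsAnalyticEVD.limiting_eq_or_eq_neg
    (h : IsAnalyticEVD (scaledKernelMatrix f x) lam P)
    (hf : HasSmoothnessOrder a r f) (ha : 0 < a)
    (hpsd : ∀ᶠ ε in 𝓝[>] (0 : ℝ), (scaledKernelMatrix f x ε).PosSemidef)
    (hμ : ∀ k, HasMainTerm (lam k) (eigenvalueOrder r k) (μ k)) {s : ℕ} (hsr : s ≤ r)
    (hμ0 : ∀ k : Fin n, (k : ℕ) < s → μ k ≠ 0) {p : Fin n → Fin n → ℝ}
    (hp : IsLimitingEigenvectors P p) {Q : Matrix (Fin n) (Fin n) ℝ} {R : Matrix (Fin n) (Fin s) ℝ}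
    (hQR : IsFullQR (vandermonde x s) Q R) (k : Fin n) (hk : (k : ℕ) < s) :
    p k = (fun i => Q i k) ∨ p k = -(fun i => Q i k) := by
  have hQx : ∀ (j : Fin n) (b : ℕ), b < s → b < j → ((fun i => Q i j) ⬝ᵥ fun i => x i ^ b) = 0 := by
    intro j b hb hbj
    have h1 : Q.transpose * vandermonde x s = R := by
      rw [hQR.eq_mul, ← Matrix.mul_assoc, hQR.orthogonal, Matrix.one_mul]
    rw [← hQR.upper j ⟨b, hb⟩ hbj, ← h1]
    rfl
  induction hN : (k : ℕ) using Nat.strong_induction_on generalizing k with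
  | _ N ih =>
  subst hN
  have h1 : ∀ j, j ≠ k → (fun i => Q i j) ⬝ᵥ p k = 0 := by
    intro j hjk
    rcases lt_or_gt_of_ne hjk with hlt | hgt
    · have h2 : p j ⬝ᵥ p k = 0 := by
        rw [h.orthonormal_limiting hp, Matrix.one_apply_ne hjk]
      rcases ih j hlt j (lt_trans hlt hk) rfl with h3 | h3
      · rw [← h3, h2]
      · rw [h3, neg_dotProduct, neg_eq_zero] at h2
        exact h2
    · exact h.dotProduct_limiting_eq_zero hf ha hpsd hμ hp (lt_of_lt_of_le hk hsr) (hμ0 k hk)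
        fun b hb => hQx j b (lt_of_le_of_lt hb hk) (lt_of_le_of_lt hb hgt)
  set c := (fun i => Q i k) ⬝ᵥ p k
  have h2 : p k = c • fun i => Q i k := by
    have h3 : Q.transpose.mulVec (p k) = Pi.single k c := by
      funext j
      by_cases hjk : j = k
      · subst hjk
        rw [Pi.single_eq_same]
        rfl
      · rw [Pi.single_eq_of_ne hjk]
        exact h1 j hjk
    have h4 : Q.mulVec (Q.transpose.mulVec (p k)) = p k := by
      rw [Matrix.mulVec_mulVec, mul_eq_one_comm.1 hQR.orthogonal, Matrix.one_mulVec]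
    rw [← h4, h3]
    funext i
    rw [Matrix.mulVec_single]
    simp [mul_comm]
  have h3 : c * c = 1 := by
    have h4 : p k ⬝ᵥ p k = 1 := by rw [h.orthonormal_limiting hp, Matrix.one_apply_eq]
    have h5 : (fun i => Q i k) ⬝ᵥ (fun i => Q i k) = 1 := by
      have : (Q.transpose * Q) k k = 1 := by rw [hQR.orthogonal, Matrix.one_apply_eq]
      exact this
    rw [h2, smul_dotProduct, dotProduct_smul, h5] at h4
    simpa using h4
  rcases mul_self_eq_one_iff.1 h3 with h4 | h4
  · left; rw [h2, h4, one_smul]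
  · right; rw [h2, h4, neg_one_smul]

/-- The columns of `Qp` are orthogonal to the first `r` limiting eigenvectors, hence lie in the span
of the others; both dimensions are `n - r`. -/
theorem IsAnalyticEVD.span_limiting_eq_range
    (h : IsAnalyticEVD (scaledKernelMatrix f x) lam P)
    (hf : HasSmoothnessOrder a r f) (ha : 0 < a)
    (hpsd : ∀ᶠ ε in 𝓝[>] (0 : ℝ), (scaledKernelMatrix f x ε).PosSemidef)
    (hμ : ∀ k, HasMainTerm (lam k) (eigenvalueOrder r k) (μ k)) (hrn : r ≤ n)
    (hμ0 : ∀ k : Fin n, (k : ℕ) < r → μ k ≠ 0) {p : Fin n → Fin n → ℝ}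
    (hp : IsLimitingEigenvectors P p) {Qp : Matrix (Fin n) (Fin (n - r)) ℝ}
    (hQ : Qp.transpose * Qp = 1) (hQV : Qp.transpose * vandermonde x r = 0) :
    Submodule.span ℝ (p '' {k : Fin n | r ≤ (k : ℕ)}) = LinearMap.range Qp.mulVecLin := by
  have h1 : ∀ (j : Fin (n - r)) (k : Fin n), (k : ℕ) < r → Qp.col j ⬝ᵥ p k = 0 := fun j k hk =>
    h.dotProduct_limiting_eq_zero hf ha hpsd hμ hp hk (hμ0 k hk) fun b hb =>
      congrFun (congrFun hQV j) ⟨b, lt_of_le_of_lt hb hk⟩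
  have hle : LinearMap.range Qp.mulVecLin ≤ Submodule.span ℝ (p '' {k : Fin n | r ≤ (k : ℕ)}) := by
    rw [Matrix.range_mulVecLin, Submodule.span_le]
    rintro _ ⟨j, rfl⟩
    let U : Matrix (Fin n) (Fin n) ℝ := Matrix.of fun i k => p k i
    have hU : U.transpose * U = 1 := by
      ext i k
      exact h.orthonormal_limiting hp i k
    have h2 : Qp.col j = ∑ k, (Qp.col j ⬝ᵥ p k) • p k := by
      have h3 : U.mulVec (U.transpose.mulVec (Qp.col j)) = Qp.col j := by
        rw [Matrix.mulVec_mulVec, mul_eq_one_comm.1 hU, Matrix.one_mulVec]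
      conv_lhs => rw [← h3]
      funext i
      rw [Finset.sum_apply]
      change ∑ k, p k i * (p k ⬝ᵥ Qp.col j) = ∑ k, (Qp.col j ⬝ᵥ p k) * p k i
      exact Finset.sum_congr rfl fun k _ => by rw [dotProduct_comm, mul_comm]
    rw [SetLike.mem_coe, h2]
    refine Submodule.sum_mem _ fun k _ => ?_
    by_cases hk : r ≤ (k : ℕ)
    · exact Submodule.smul_mem _ _ (Submodule.subset_span ⟨k, hk, rfl⟩)
    · rw [h1 j k (not_le.1 hk), zero_smul]
      exact Submodule.zero_mem _
  refine (Submodule.eq_of_le_of_finrank_le hle ?_).symm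
  have hinj : Function.Injective Qp.mulVecLin := by
    refine Function.LeftInverse.injective (g := Qp.transpose.mulVec) fun v => ?_
    rw [Matrix.mulVecLin_apply, Matrix.mulVec_mulVec, hQ, Matrix.one_mulVec]
  rw [LinearMap.finrank_range_of_inj hinj, Module.finrank_fin_fun]
  classical
  have h2 : p '' {k : Fin n | r ≤ (k : ℕ)} =
      ((Finset.univ.filter fun k : Fin n => r ≤ (k : ℕ)).image p : Finset (Fin n → ℝ)) := by
    simp
  rw [h2]
  refine (finrank_span_finset_le_card _).trans (Finset.card_image_le.trans (le_of_eq ?_))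
  -- The product of the constant `2` turns the reindexing of products into a count of the indices `k
  -- ≥ r`.
  have h3 := prod_filter_ge hrn fun _ => 2
  rw [Finset.prod_const, Finset.prod_const, Finset.card_univ, Fintype.card_fin] at h3
  exact Nat.pow_right_injective le_rfl h3

/-- The last vectors of an adapted basis may be taken to be the columns of any admissible `Qp`; the
lower right block then becomes the projected distance matrix. -/
theorem IsAnalyticEVD.charpoly_eq
    (h : IsAnalyticEVD (scaledKernelMatrix f x) lam P)
    (hf : HasSmoothnessOrder a r f) (ha : 0 < a)
    (hμ : ∀ k, HasMainTerm (lam k) (eigenvalueOrder r k) (μ k)) (hrn : r ≤ n)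
    (hx : Function.Injective x) (hW : (wronskian (radialKernel f) r).det ≠ 0)
    {Qp : Matrix (Fin n) (Fin (n - r)) ℝ}
    (hQ : Qp.transpose * Qp = 1) (hQV : Qp.transpose * vandermonde x r = 0) :
    (taylorCoeff f (2 * r - 1) • (Qp.transpose * distPow x (2 * r - 1) * Qp)).charpoly =
      ∏ k ∈ Finset.univ.filter (fun k : Fin n => r ≤ (k : ℕ)),
        (Polynomial.X - Polynomial.C (μ k)) := by
  have hV := det_transpose_mul_vandermonde_ne_zero hrn hx
  obtain ⟨w, hw⟩ := exists_isAdaptedBasis hrn x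
  have h1 := (h.prod_mainTerms_and_charpoly hf ha hμ hf.pos le_rfl hrn
    (hw.replace_right hrn hV hQ hQV)).2 rfl (mul_ne_zero hV hW)
  rw [prod_filter_ge hrn, ← h1]
  congr 1
  ext i j
  rw [taylorMatrix, ← Matrix.smul_mul, ← Matrix.mul_smul, Matrix.mul_assoc]
  rfl

theorem scaledKernelMatrix_transpose (f : ℝ → ℝ) (x : Fin n → ℝ) (ε : ℝ) :
    (scaledKernelMatrix f x ε).transpose = scaledKernelMatrix f x ε := by
  ext i j
  simp [scaledKernelMatrix, abs_sub_comm]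
end

end FlatLimit

theorem mainTheorem5 (n r : ℕ) (hrn : r ≤ n) (a : ℝ) (ha : 0 < a) (f : ℝ → ℝ)
    (hf : FlatLimit.HasSmoothnessOrder a r f) (x : Fin n → ℝ)
    (hpsd : ∃ ε₀ : ℝ, 0 < ε₀ ∧
      ∀ ε ∈ Set.Icc (0 : ℝ) ε₀, (FlatLimit.scaledKernelMatrix f x ε).PosSemidef)
    (hanalytic : ∀ i j, AnalyticAt ℝ (fun ε => FlatLimit.scaledKernelMatrix f x ε i j) 0) :
    (∃ (lam : Fin n → ℝ → ℝ) (P : Fin n → ℝ → Matrix (Fin n) (Fin n) ℝ),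
      FlatLimit.IsAnalyticEVD (FlatLimit.scaledKernelMatrix f x) lam P) ∧
    ∀ (lam : Fin n → ℝ → ℝ) (P : Fin n → ℝ → Matrix (Fin n) (Fin n) ℝ),
      FlatLimit.IsAnalyticEVD (FlatLimit.scaledKernelMatrix f x) lam P →
      ∃ μ : Fin n → ℝ,
        -- the orders of the eigenvalues; `μ k` are their main terms
        (∀ k, FlatLimit.HasMainTerm (lam k) (FlatLimit.eigenvalueOrder r k) (μ k)) ∧
        -- 1. main terms of the first `r` eigenvalues
        (∀ s : ℕ, 1 ≤ s → s ≤ r →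
          ∏ k ∈ Finset.univ.filter (fun k : Fin n => (k : ℕ) < s), μ k =
            ((FlatLimit.vandermonde x s).transpose * FlatLimit.vandermonde x s).det *
              (FlatLimit.wronskian (FlatLimit.radialKernel f) s).det) ∧
        (∀ k : Fin n, 0 < (k : ℕ) → (k : ℕ) < r →
          ((FlatLimit.vandermonde x k).transpose * FlatLimit.vandermonde x k).det ≠ 0 →
          (FlatLimit.wronskian (FlatLimit.radialKernel f) k).det ≠ 0 →
          μ k =
            ((FlatLimit.vandermonde x (k + 1)).transpose *
                FlatLimit.vandermonde x (k + 1)).det /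
              ((FlatLimit.vandermonde x k).transpose * FlatLimit.vandermonde x k).det *
            ((FlatLimit.wronskian (FlatLimit.radialKernel f) (k + 1)).det /
              (FlatLimit.wronskian (FlatLimit.radialKernel f) k).det)) ∧
        -- 2. the first `s` limiting eigenvectors
        (Function.Injective x → ∀ s : ℕ, 1 ≤ s → s ≤ r →
          (FlatLimit.wronskian (FlatLimit.radialKernel f) s).det ≠ 0 →
          ∀ p : Fin n → Fin n → ℝ, FlatLimit.IsLimitingEigenvectors P p →
          ∀ (Q : Matrix (Fin n) (Fin n) ℝ) (R : Matrix (Fin n) (Fin s) ℝ),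
            FlatLimit.IsFullQR (FlatLimit.vandermonde x s) Q R →
            ∀ k : Fin n, (k : ℕ) < s →
              p k = (fun i => Q i k) ∨ p k = -(fun i => Q i k)) ∧
        -- 2. (continued) and 3. the last `n - r` limiting eigenvectors and main terms
        (Function.Injective x →
          (FlatLimit.wronskian (FlatLimit.radialKernel f) r).det ≠ 0 →
          ∀ Qp : Matrix (Fin n) (Fin (n - r)) ℝ,
            Qp.transpose * Qp = 1 → Qp.transpose * FlatLimit.vandermonde x r = 0 →
            (∀ p : Fin n → Fin n → ℝ, FlatLimit.IsLimitingEigenvectors P p →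
              Submodule.span ℝ (p '' {k : Fin n | r ≤ (k : ℕ)}) =
                LinearMap.range Qp.mulVecLin) ∧
            (FlatLimit.taylorCoeff f (2 * r - 1) •
                (Qp.transpose * FlatLimit.distPow x (2 * r - 1) * Qp)).charpoly =
              ∏ k ∈ Finset.univ.filter (fun k : Fin n => r ≤ (k : ℕ)),
                (Polynomial.X - Polynomial.C (μ k))) := by
  have hpsd' : ∀ᶠ ε in 𝓝[>] (0 : ℝ), (FlatLimit.scaledKernelMatrix f x ε).PosSemidef := by
    obtain ⟨ε₀, hε₀, hK⟩ := hpsd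
    filter_upwards [Ioo_mem_nhdsGT hε₀] with ε hε
    exact hK ε ⟨hε.1.le, hε.2.le⟩
  refine ⟨FlatLimit.exists_isAnalyticEVD hanalytic
    (Eventually.of_forall (FlatLimit.scaledKernelMatrix_transpose f x)), fun lam P h => ?_⟩
  obtain ⟨μ, hμ⟩ := h.exists_mainTerms hf ha hpsd'
  refine ⟨μ, hμ, fun s hs hsr => h.prod_mainTerms hf ha hμ hrn hs hsr,
    fun k hk hkr hV hW => h.mainTerm_eq_div hf ha hμ hrn k hk hkr hV hW, ?_, ?_⟩
  · intro hx s hs hsr hW p hp Q R hQR k hk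
    exact h.limiting_eq_or_eq_neg hf ha hpsd' hμ hsr
      (fun k hk => h.mainTerm_ne_zero hf ha hμ hrn hx hs hsr hW hk) hp hQR k hk
  · intro hx hW Qp hQ hQV
    exact ⟨fun p hp => h.span_limiting_eq_range hf ha hpsd' hμ hrn
      (fun k hk => h.mainTerm_ne_zero hf ha hμ hrn hx hf.pos le_rfl hW hk) hp hQ hQV,
      h.charpoly_eq hf ha hμ hrn hx hW hQ hQV⟩
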